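/- For a configuration of four points $p_1,\dots,p_4\in\mathbb{C}^2$ and $1\le i<j\le 4$ put $m_{ij}(p)=\sum_{k=1}^{2}(p_i^k-p_j^k)^2$ (no conjugation), and let $M_{2,4}\subset\mathbb{C}^6$ be the set of all vectors $(m_{ij}(p))_{i<j}$. Let $L_{2,4}\subset\mathbb{C}^6$ be the preimage of $M_{2,4}$ under the map $(l_{ij})\mapsto(l_{ij}^2)$; it is an affine variety. A point $x$ of an affine variety $V\subseteq\mathbb{C}^N$ is singular if the dimension of the Zariski tangent space $\{v\in\mathbb{C}^N : \sum_i \partial_i f(x)\,v_i=0 \text{ for all } f\in I(V)\}$ differs from the local dimension of $V$ at $x$, that is, from the largest dimension of an irreducible component of $V$ containing $x$. Then the singular locus of $L_{2,4}$ is the union of exactly $60$ distinct three-dimensional linear subspaces of $\mathbb{C}^6$, and these $60$ subspaces are precisely the three-dimensional linear subspaces of $\mathbb{C}^6$ contained in $L_{2,4}$. Moreover, $L_{2,4}$ contains no linear subspace of dimension at least $4$. -/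

import Mathlib

namespace UnsquaredMeasurement

/-- The pairs `ij` with `i < j`, indexing the coordinates of `ℂ^N`, `N = n.choose 2`. -/
abbrev Edge (n : ℕ) : Type := {e : Fin n × Fin n // e.1 < e.2}

/-- The complex squared length of every edge of a complex configuration of `n` points in `ℂ^d`
(no conjugation). -/
def squaredLengths {d n : ℕ} (p : Fin n → Fin d → ℂ) : Edge n → ℂ :=
  fun e => ∑ k : Fin d, (p e.1.1 k - p e.1.2 k) ^ 2

/-- The squared measurement variety `M_{d,n}`. -/
def M (d n : ℕ) : Set (Edge n → ℂ) :=
  Set.range (squaredLengths : (Fin n → Fin d → ℂ) → Edge n → ℂ)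

/-- The coordinatewise squaring map. -/
def squaring {σ : Type} (l : σ → ℂ) : σ → ℂ := fun e => l e ^ 2

/-- The unsquared measurement variety `L_{d,n}`: the preimage of `M_{d,n}` under squaring. -/
def L (d n : ℕ) : Set (Edge n → ℂ) := squaring ⁻¹' M d n

section Variety

variable {σ : Type}

/-- Affine varieties (algebraic subsets) of `ℂ^σ`, not necessarily irreducible. -/
def IsVariety (V : Set (σ → ℂ)) : Prop :=
  ∃ I : Ideal (MvPolynomial σ ℂ), V = MvPolynomial.zeroLocus ℂ I

/-- Irreducible varieties. -/
def IsIrreducibleVariety (V : Set (σ → ℂ)) : Prop :=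
  IsVariety V ∧ V.Nonempty ∧
    ∀ V₁ V₂ : Set (σ → ℂ), IsVariety V₁ → IsVariety V₂ → V = V₁ ∪ V₂ → V = V₁ ∨ V = V₂

/-- The components of `V`: its maximal irreducible subvarieties. -/
def components (V : Set (σ → ℂ)) : Set (Set (σ → ℂ)) :=
  {Z | Maximal (fun Y : Set (σ → ℂ) => IsIrreducibleVariety Y ∧ Y ⊆ V) Z}

/-- The dimension of a variety: the Krull dimension of its coordinate ring. -/
noncomputable def dimension (V : Set (σ → ℂ)) : WithBot ℕ∞ :=
  ringKrullDim (MvPolynomial σ ℂ ⧸ MvPolynomial.vanishingIdeal ℂ V)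

/-- The local dimension of `V` at `x`: the largest dimension of a component containing `x`. -/
noncomputable def localDimension (V : Set (σ → ℂ)) (x : σ → ℂ) : WithBot ℕ∞ :=
  ⨆ Z ∈ {Z | Z ∈ components V ∧ x ∈ Z}, dimension Z

/-- The Zariski tangent space of `V` at `x`: the vectors annihilated by the differentials at `x`
of all polynomials in `I(V)`. For `x ∈ V` this is the kernel at `x` of the Jacobian matrix of any
generating set of `I(V)`. -/
noncomputable def tangentSpace [Fintype σ] (V : Set (σ → ℂ)) (x : σ → ℂ) :
    Submodule ℂ (σ → ℂ) where
  carrier := {v | ∀ f ∈ MvPolynomial.vanishingIdeal ℂ V,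
    ∑ i, MvPolynomial.eval x (MvPolynomial.pderiv i f) * v i = 0}
  add_mem' := by
    intro v w hv hw f hf
    simp [mul_add, Finset.sum_add_distrib, hv f hf, hw f hf]
  zero_mem' := by
    intro f _
    simp
  smul_mem' := by
    intro c v hv f hf
    have h := hv f hf
    simp only [Pi.smul_apply, smul_eq_mul, mul_left_comm _ c, ← Finset.mul_sum, h, mul_zero]

/-- The singular locus: the points of `V` where the dimension of the Zariski tangent space differs
from the local dimension. -/
noncomputable def singularLocus [Fintype σ] (V : Set (σ → ℂ)) : Set (σ → ℂ) :=
  {x | x ∈ V ∧ ((Module.finrank ℂ (tangentSpace V x) : ℕ) : WithBot ℕ∞) ≠ localDimension V x}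

end Variety

end UnsquaredMeasurement

/-! A complex symmetric 3 × 3 matrix is a Gram matrix of vectors in `ℂ²` exactly when it is
singular, so `L 2 4` is the hypersurface of the Cayley–Menger polynomial in the squared lengths
(`mem_L_iff`). This polynomial is irreducible (`irreducible_volumePoly`), hence it generates the
vanishing ideal, and the singular points are those where its gradient vanishes.

On a planar realization, the derivative along the edge `ij` is a constant times the length of `ij`
times the areas of the two faces containing the opposite edge `km` (`cayleyMengerDeriv_planar`). So
any two faces of nonzero area force the edge joining their apexes to have length zero. If all areas
vanish, the configuration is collinear. Otherwise at least two areas are nonzero: if exactly two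
are, two points coincide; if three are, some face has three edges of length zero. Choosing signs of
square roots gives 32 subspaces of collinear type, 6 · 4 with coincident points and 4 with a null
face: 60 in all.

Conversely, on a three-dimensional subspace `W` of `L 2 4` three of the lengths are free
coordinates, and the others are linear forms in them. The three edges form a triangle, a star or a
path. Substituting into the volume equation gives coincident points for a triangle
(`twin_of_face_free`), a collinear configuration or a null face for a star (`star_free`), and a
contradiction for a path (`path_not_free`). Thus `W` is covered by the 60 subspaces, so it lies in
one of them and equals it by dimension. In dimension at least four, every vector lies in a
three-dimensional subspace, so the whole space would again lie in one of the 60. -/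

namespace UnsquaredMeasurement

/-! ### The volume equation of `L 2 4` -/

/-- Four times the determinant of the Gram matrix of three vectors based at a common point, in
terms of the six squared distances `m₁₂, m₁₃, m₁₄, m₂₃, m₂₄, m₃₄` of the four points. -/
def cayleyMenger {R : Type*} [CommRing R] (a b c d e f : R) : R :=
  4 * a * b * c + (a + b - d) * (a + c - e) * (b + c - f) - a * (b + c - f) ^ 2
    - b * (a + c - e) ^ 2 - c * (a + b - d) ^ 2

/-- The coordinates of `l`, as a symmetric function of two vertices. -/
def len {R : Type*} [Zero R] {n : ℕ} (l : Edge n → R) (i j : Fin n) : R :=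
  if h : i < j then l ⟨(i, j), h⟩ else if h : j < i then l ⟨(j, i), h⟩ else 0

theorem len_of_lt {R : Type*} [Zero R] {n : ℕ} (l : Edge n → R) {i j : Fin n} (h : i < j) :
    len l i j = l ⟨(i, j), h⟩ := by
  simp [len, h]

theorem len_edge {R : Type*} [Zero R] {n : ℕ} (l : Edge n → R) (e : Edge n) : len l e.1.1 e.1.2 = l e :=
  len_of_lt l e.2

theorem len_self {R : Type*} [Zero R] {n : ℕ} (l : Edge n → R) (i : Fin n) : len l i i = 0 := by
  simp [len]

theorem len_comm {R : Type*} [Zero R] {n : ℕ} (l : Edge n → R) (i j : Fin n) : len l i j = len l j i := by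
  rcases lt_trichotomy i j with h | h | h
  · simp [len, h, h.not_gt]
  · simp [h]
  · simp [len, h, h.not_gt]

theorem len_sq_eq_of_forall_edge {n : ℕ} {l : Edge n → ℂ} {g : Fin n → Fin n → ℂ}
    (hs : ∀ i j, g i j = g j i) (h0 : ∀ i, g i i = 0)
    (h : ∀ e : Edge n, l e ^ 2 = g e.1.1 e.1.2) (i j : Fin n) : len l i j ^ 2 = g i j := by
  rcases lt_trichotomy i j with hij | hij | hij
  · rw [len_of_lt l hij, h]
  · subst hij; simp [len_self, h0]
  · rw [len_comm, len_of_lt l hij, h, hs]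

theorem mem_L_iff_exists {d n : ℕ} {l : Edge n → ℂ} :
    l ∈ L d n ↔ ∃ p : Fin n → Fin d → ℂ, ∀ i j, len l i j ^ 2 = ∑ k, (p i k - p j k) ^ 2 := by
  constructor
  · rintro ⟨p, hp⟩
    refine ⟨p, len_sq_eq_of_forall_edge (fun i j => ?_) (by simp) fun e => ?_⟩
    · exact Finset.sum_congr rfl fun k _ => by ring
    · exact (congrFun hp e).symm
  · rintro ⟨p, hp⟩
    refine ⟨p, funext fun e => ?_⟩
    have := hp e.1.1 e.1.2
    rw [len_edge] at this
    exact this.symm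

theorem cayleyMenger_planar {R : Type*} [CommRing R] (p q r s : Fin 2 → R) :
    cayleyMenger (∑ k, (p k - q k) ^ 2) (∑ k, (p k - r k) ^ 2) (∑ k, (p k - s k) ^ 2)
      (∑ k, (q k - r k) ^ 2) (∑ k, (q k - s k) ^ 2) (∑ k, (r k - s k) ^ 2) = 0 := by
  simp only [Fin.sum_univ_two, cayleyMenger]
  ring

theorem cayleyMenger_len_eq_zero {l : Edge 4 → ℂ} (hl : l ∈ L 2 4) (i j k m : Fin 4) :
    cayleyMenger (len l i j ^ 2) (len l i k ^ 2) (len l i m ^ 2) (len l j k ^ 2)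
      (len l j m ^ 2) (len l k m ^ 2) = 0 := by
  obtain ⟨p, hp⟩ := mem_L_iff_exists.1 hl
  simp only [hp, cayleyMenger_planar]

/-- A singular complex symmetric matrix of size `3` is the Gram matrix of vectors in `ℂ²`. -/
theorem exists_gram_of_det_eq_zero (G : Matrix (Fin 3) (Fin 3) ℂ) (hG : G.IsSymm)
    (hdet : G.det = 0) : ∃ v : Fin 3 → Fin 2 → ℂ, ∀ i j, G i j = ∑ k, v i k * v j k := by
  let B : LinearMap.BilinForm ℂ (Fin 3 → ℂ) := Matrix.toBilin' G
  have hB : B.IsSymm := Matrix.isSymm_toBilin'_iff_isSymm.2 hG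
  have : Invertible (2 : ℂ) := invertibleOfNonzero two_ne_zero
  obtain ⟨b', hb'⟩ := LinearMap.BilinForm.exists_orthogonal_basis
    (LinearMap.BilinForm.isSymm_iff.1 hB)
  let b : Module.Basis (Fin 3) ℂ (Fin 3 → ℂ) := b'.reindex (finCongr (by simp))
  have hb : ∀ i j, i ≠ j → B (b i) (b j) = 0 := fun i j hij => by
    simp only [b, Module.Basis.reindex_apply]
    exact hb' (by simpa using hij)
  have expand : ∀ x y, B x y = ∑ i, b.repr x i * b.repr y i * B (b i) (b i) := fun x y => by
    conv_lhs => rw [← b.sum_repr x, ← b.sum_repr y]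
    simp only [map_sum, LinearMap.sum_apply, map_smul, LinearMap.smul_apply, smul_eq_mul]
    refine Finset.sum_congr rfl fun i _ => ?_
    rw [Finset.sum_eq_single i]
    · ring
    · intro j _ hj
      simp [hb _ _ hj]
    · simp
  -- A kernel vector `w` has a nonzero coordinate at some `i₀`; pairing it with `b i₀` shows that `b
  -- i₀` is isotropic, so two diagonal terms remain. Their square roots rescale the coordinates to
  -- the standard form on `ℂ²`.
  obtain ⟨w, hw0, hw⟩ := Matrix.exists_mulVec_eq_zero_iff.2 hdet
  have hBw : ∀ x, B x w = 0 := fun x => by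
    simp [B, Matrix.toBilin'_apply', hw]
  obtain ⟨i₀, hi₀⟩ : ∃ i, b.repr w i ≠ 0 := by
    by_contra! h
    exact hw0 (b.repr.map_eq_zero_iff.1 (Finsupp.ext h))
  have hd : B (b i₀) (b i₀) = 0 := by
    have h := hBw (b i₀)
    rw [expand, Finset.sum_eq_single i₀] at h
    · simpa [hi₀] using h
    · intro j _ hj
      simp [hj.symm]
    · simp
  choose s hs using fun i => IsAlgClosed.exists_pow_nat_eq (B (b i) (b i)) zero_lt_two
  refine ⟨fun i k => b.repr (Pi.single i 1) (i₀.succAbove k) * s (i₀.succAbove k), fun i j => ?_⟩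
  have hGij : G i j = B (Pi.single i 1) (Pi.single j 1) := by
    simp [B, Matrix.toBilin'_single]
  rw [hGij, expand, Fin.sum_univ_succAbove _ i₀, hd, mul_zero, zero_add]
  refine Finset.sum_congr rfl fun k _ => ?_
  rw [← hs]
  ring

theorem mem_L_iff {l : Edge 4 → ℂ} :
    l ∈ L 2 4 ↔ cayleyMenger (len l 0 1 ^ 2) (len l 0 2 ^ 2) (len l 0 3 ^ 2) (len l 1 2 ^ 2)
      (len l 1 3 ^ 2) (len l 2 3 ^ 2) = 0 := by
  refine ⟨fun hl => cayleyMenger_len_eq_zero hl 0 1 2 3, fun h => ?_⟩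
  -- Polarization: the inner products of the edge vectors at vertex 0 are determined by the squared
  -- lengths.
  let G : Matrix (Fin 3) (Fin 3) ℂ := Matrix.of fun i j =>
    (len l 0 i.succ ^ 2 + len l 0 j.succ ^ 2 - len l i.succ j.succ ^ 2) / 2
  obtain ⟨v, hv⟩ := exists_gram_of_det_eq_zero G
    (Matrix.IsSymm.ext fun i j => by simp only [G, Matrix.of_apply, len_comm l j.succ]; ring) (by
      simp only [Matrix.det_fin_three, G, Matrix.of_apply, len_self]
      simp only [cayleyMenger] at h
      simp only [Fin.succ_zero_eq_one, Fin.succ_one_eq_two,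
        show (Fin.succ 2 : Fin 4) = 3 from rfl, len_comm l 2 1, len_comm l 3 1, len_comm l 3 2]
      linear_combination h / 4)
  have hself : ∀ i : Fin 3, len l 0 i.succ ^ 2 = ∑ k, v i k * v i k := fun i => by
    rw [← hv]
    simp only [G, Matrix.of_apply, len_self]
    ring
  refine mem_L_iff_exists.2 ⟨Fin.cons 0 v, fun i j => ?_⟩
  refine Fin.cases ?_ (fun i => ?_) i <;> refine Fin.cases ?_ (fun j => ?_) j
  · simp [len_self]
  · simp [hself, pow_two]
  · rw [len_comm]
    simp [hself, pow_two]
  · have h1 := hv i j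
    simp only [G, Matrix.of_apply, hself, Fin.sum_univ_two] at h1
    simp only [Fin.cons_succ, Fin.sum_univ_two]
    linear_combination (-2) * h1

/-! ### Irreducibility of the volume equation -/

open MvPolynomial in
theorem natDegree_aeval_le_totalDegree {σ R A : Type*} [CommRing R] [CommRing A] [Algebra R A]
    (g : σ → Polynomial A) (hg : ∀ i, (g i).natDegree ≤ 1) (P : MvPolynomial σ R) :
    (aeval g P).natDegree ≤ P.totalDegree := by
  rw [aeval_def, eval₂_eq]
  refine Polynomial.natDegree_sum_le_of_forall_le _ _ fun d hd => ?_
  refine Polynomial.natDegree_mul_le.trans ?_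
  rw [IsScalarTower.algebraMap_apply R A (Polynomial A), Polynomial.algebraMap_eq,
    Polynomial.natDegree_C, zero_add]
  refine (Polynomial.natDegree_prod_le _ _).trans ((Finset.sum_le_sum fun i _ => ?_).trans
    (le_totalDegree hd))
  exact Polynomial.natDegree_pow_le.trans ((Nat.mul_le_mul_left _ (hg i)).trans (by simp))

open MvPolynomial in
/-- A polynomial is irreducible if it becomes so under a substitution by polynomials of degree at
most one which does not lower its degree. -/
theorem irreducible_of_irreducible_aeval {σ K A : Type*} [Field K] [CommRing A] [IsDomain A]
    [Algebra K A] (g : σ → Polynomial A) (hg : ∀ i, (g i).natDegree ≤ 1) (P : MvPolynomial σ K)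
    (hP : Irreducible (aeval g P)) (hdeg : P.totalDegree ≤ (aeval g P).natDegree) :
    Irreducible P := by
  have key : ∀ Q R : MvPolynomial σ K, P = Q * R → IsUnit (aeval g Q) → IsUnit Q := by
    rintro Q R rfl hQ
    have hne : Q * R ≠ 0 := fun h => hP.ne_zero (by rw [h, map_zero])
    -- The image of `Q` has degree zero, so the whole degree of `Q * R` is carried by `R`; hence `Q`
    -- is a constant.
    have h0 : (aeval g Q).natDegree = 0 := Polynomial.natDegree_eq_zero_of_isUnit hQ
    have hR := natDegree_aeval_le_totalDegree g hg R
    rw [totalDegree_mul_of_isDomain (left_ne_zero_of_mul hne) (right_ne_zero_of_mul hne),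
      map_mul] at hdeg
    have := Polynomial.natDegree_mul_le (p := aeval g Q) (q := aeval g R)
    obtain ⟨c, rfl⟩ : ∃ c, Q = C c := ⟨_, totalDegree_eq_zero_iff_eq_C.1 (by omega)⟩
    refine (IsUnit.mk0 c fun hc => hne ?_).map C
    simp [hc]
  refine ⟨fun h => hP.not_isUnit (h.map _), fun Q R hQR => ?_⟩
  rcases hP.isUnit_or_isUnit (by rw [hQR, map_mul]) with h | h
  · exact Or.inl (key Q R hQR h)
  · exact Or.inr (key R Q (by rw [hQR, mul_comm]) h)

/-- The equation of `L_{2,4}`. -/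
noncomputable def volumePoly : MvPolynomial (Edge 4) ℂ :=
  cayleyMenger (MvPolynomial.X ⟨(0, 1), by decide⟩ ^ 2) (MvPolynomial.X ⟨(0, 2), by decide⟩ ^ 2)
    (MvPolynomial.X ⟨(0, 3), by decide⟩ ^ 2) (MvPolynomial.X ⟨(1, 2), by decide⟩ ^ 2)
    (MvPolynomial.X ⟨(1, 3), by decide⟩ ^ 2) (MvPolynomial.X ⟨(2, 3), by decide⟩ ^ 2)

theorem map_cayleyMenger {R S : Type*} [CommRing R] [CommRing S] (φ : R →+* S)
    (a b c d e f : R) : φ (cayleyMenger a b c d e f) =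
      cayleyMenger (φ a) (φ b) (φ c) (φ d) (φ e) (φ f) := by
  simp [cayleyMenger, map_ofNat]

theorem totalDegree_volumePoly_le : volumePoly.totalDegree ≤ 6 := by
  have hX : ∀ e : Edge 4, (MvPolynomial.X (R := ℂ) e ^ 2).IsHomogeneous 2 := fun e => by
    simpa using (MvPolynomial.isHomogeneous_X ℂ e).pow 2
  have h4 : (4 : MvPolynomial (Edge 4) ℂ).IsHomogeneous 0 := by
    exact MvPolynomial.isHomogeneous_C (Edge 4) (4 : ℂ)
  refine MvPolynomial.IsHomogeneous.totalDegree_le ?_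
  unfold volumePoly cayleyMenger
  refine .sub (.sub (.sub (.add ?_ ?_) ?_) ?_) ?_
  · exact ((h4.mul (hX _)).mul (hX _)).mul (hX _)
  · exact ((((hX _).add (hX _)).sub (hX _)).mul (((hX _).add (hX _)).sub (hX _))).mul
      (((hX _).add (hX _)).sub (hX _))
  all_goals exact (hX _).mul ((((hX _).add (hX _)).sub (hX _)).pow 2)

section Irreducible

open Polynomial

/-- An explicit plane in `ℂ^6` on which the equation of `L_{2,4}` is Eisenstein. -/
noncomputable def eisensteinPlane (e : Edge 4) : ℂ[X][X] :=
  -- The Eisenstein prime is the inner variable `C X`. Where it vanishes, `l₁₂ = l₀₁ - l₀₂`: a face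
  -- is degenerate and the volume is minus a square. The constants make this square `(480 * X ^ 3) ^
  -- 2`, so only the leading coefficient survives modulo the prime.
  !![0, 8, 3 * X + 9, 14 * X;
     0, 0, C X - 1 - 3 * X, 6 * X;
     0, 0, 0, 5 * X + 3;
     0, 0, 0, 0] e.1.1 e.1.2

theorem natDegree_eisensteinPlane_le (e : Edge 4) : (eisensteinPlane e).natDegree ≤ 1 := by
  obtain ⟨⟨i, j⟩, h⟩ := e
  fin_cases i <;> fin_cases j <;> simp [eisensteinPlane] <;> compute_degree

theorem aeval_eisensteinPlane : MvPolynomial.aeval eisensteinPlane volumePoly =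
    C (-230400) * X ^ 6 + C (172800 * X) * X ^ 5 + C (-32256 * X - 35856 * X ^ 2) * X ^ 4
      + C (-230400 * X + 10272 * X ^ 2 + 2352 * X ^ 3) * X ^ 3
      + C (-57600 * X + 32624 * X ^ 2 + 784 * X ^ 3 - 196 * X ^ 4) * X ^ 2
      + C (30720 * X - 1536 * X ^ 2) * X + C (9216 * X - 4608 * X ^ 2) := by
  have h := map_cayleyMenger (MvPolynomial.aeval (R := ℂ) eisensteinPlane).toRingHom
  simp only [AlgHom.toRingHom_eq_coe, RingHom.coe_coe] at h
  rw [volumePoly, h]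
  simp only [map_pow, MvPolynomial.aeval_X]
  simp only [eisensteinPlane, cayleyMenger, Matrix.of_apply, Matrix.cons_val', Matrix.cons_val,
    map_add, map_sub, map_mul, map_pow, map_neg, map_ofNat]
  ring

theorem irreducible_volumePoly : Irreducible volumePoly := by
  have hdeg : (MvPolynomial.aeval eisensteinPlane volumePoly).natDegree = 6 := by
    rw [aeval_eisensteinPlane]
    compute_degree
    all_goals norm_num
  refine irreducible_of_irreducible_aeval _ natDegree_eisensteinPlane_le _ ?_
    (totalDegree_volumePoly_le.trans hdeg.ge)
  have hlead : (MvPolynomial.aeval eisensteinPlane volumePoly).leadingCoeff = -230400 := by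
    rw [leadingCoeff, hdeg, aeval_eisensteinPlane]
    simp only [coeff_add, coeff_C_mul, coeff_X_pow, coeff_X, coeff_C]
    norm_num
  have hunit : IsUnit (-230400 : ℂ[X]) := by
    have : IsUnit (C (-230400 : ℂ)) := (IsUnit.mk0 _ (by norm_num)).map C
    rwa [map_neg, map_ofNat] at this
  have hmem : ∀ n : ℕ, n < 6 → (MvPolynomial.aeval eisensteinPlane volumePoly).coeff n ∈
      Ideal.span {(X : ℂ[X])} := by
    intro n hn
    rw [Ideal.mem_span_singleton, X_dvd_iff, aeval_eisensteinPlane]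
    simp only [coeff_add, coeff_C_mul, coeff_X_pow, coeff_X, coeff_C]
    interval_cases n <;> simp
  have hprime : (Ideal.span {(X : ℂ[X])}).IsPrime :=
    (Ideal.span_singleton_prime X_ne_zero).2 prime_X
  have hne : MvPolynomial.aeval eisensteinPlane volumePoly ≠ 0 := fun h => by
    simp [h] at hdeg
  refine irreducible_of_eisenstein_criterion hprime ?_ (fun n hn => hmem n ?_) ?_ ?_ ?_
  · rw [hlead]
    exact fun h => hprime.ne_top (Ideal.eq_top_of_isUnit_mem _ h hunit)
  · rw [degree_eq_natDegree hne, hdeg] at hn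
    exact_mod_cast hn
  · rw [degree_eq_natDegree hne, hdeg]
    norm_num
  · rw [Ideal.span_singleton_pow, Ideal.mem_span_singleton, X_pow_dvd_iff, aeval_eisensteinPlane]
    intro h
    have := h 1 one_lt_two
    simp only [coeff_add, coeff_C_mul, coeff_X_pow, coeff_X, coeff_C] at this
    simp [coeff_X] at this
  · rw [isPrimitive_iff_isUnit_of_C_dvd]
    intro r hr
    have := (C_dvd_iff_dvd_coeff _ _).1 hr 6
    rw [← hdeg, ← leadingCoeff, hlead] at this
    exact isUnit_of_dvd_unit this hunit

end Irreducible

/-! ### The Jacobian criterion for irreducible hypersurfaces -/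

section Hypersurface

open MvPolynomial

variable {σ : Type}

theorem isIrreducibleVariety_of_isPrime [Finite σ] (P : Ideal (MvPolynomial σ ℂ)) [hP : P.IsPrime] :
    IsIrreducibleVariety (zeroLocus ℂ P) := by
  refine ⟨⟨P, rfl⟩, ?_, ?_⟩
  · by_contra h
    have := IsPrime.vanishingIdeal_zeroLocus (K := ℂ) P
    rw [Set.not_nonempty_iff_eq_empty.1 h, vanishingIdeal_empty] at this
    exact hP.ne_top this.symm
  · rintro _ _ ⟨I, rfl⟩ ⟨J, rfl⟩ h
    have hIJ : I * J ≤ P := by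
      rw [← IsPrime.vanishingIdeal_zeroLocus (K := ℂ) P, h]
      refine Ideal.mul_le.2 fun f hf g hg x hx => ?_
      rw [map_mul]
      rcases hx with hx | hx
      · rw [hx f hf, zero_mul]
      · rw [hx g hg, mul_zero]
    rcases hP.mul_le.1 hIJ with hI | hJ
    · exact Or.inl ((zeroLocus_anti_mono hI).antisymm (by rw [h]; exact Set.subset_union_left))
    · exact Or.inr ((zeroLocus_anti_mono hJ).antisymm (by rw [h]; exact Set.subset_union_right))

theorem components_of_isIrreducibleVariety {V : Set (σ → ℂ)} (hV : IsIrreducibleVariety V) :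
    components V = {V} := by
  ext Z
  constructor
  · intro hZ
    exact hZ.1.2.antisymm (hZ.2 ⟨hV, subset_rfl⟩ hZ.1.2)
  · rintro rfl
    exact ⟨⟨hV, subset_rfl⟩, fun Y hY _ => hY.2⟩

theorem localDimension_of_isIrreducibleVariety {V : Set (σ → ℂ)} (hV : IsIrreducibleVariety V)
    {x : σ → ℂ} (hx : x ∈ V) : localDimension V x = dimension V := by
  have : {Z | Z ∈ components V ∧ x ∈ Z} = {V} := by
    ext Z
    rw [components_of_isIrreducibleVariety hV]
    simp only [Set.mem_ofPred_eq, Set.mem_singleton_iff, and_iff_left_iff_imp]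
    rintro rfl
    exact hx
  rw [localDimension, this, iSup_singleton]

/-- The automorphism of the polynomial ring induced by a translation. -/
noncomputable def translate (c : σ → ℂ) : MvPolynomial σ ℂ ≃ₐ[ℂ] MvPolynomial σ ℂ :=
  AlgEquiv.ofAlgHom (aeval fun i => X i + C (c i)) (aeval fun i => X i - C (c i))
    (by ext i; simp [algebraMap_eq]) (by ext i; simp [algebraMap_eq])

theorem height_vanishingIdeal_singleton [Finite σ] (x y : σ → ℂ) :
    (vanishingIdeal ℂ {x} : Ideal (MvPolynomial σ ℂ)).height =
      (vanishingIdeal ℂ {y} : Ideal (MvPolynomial σ ℂ)).height := by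
  rw [← RingEquiv.height_comap (translate (y - x)).toRingEquiv]
  congr 1
  ext f
  simp only [Ideal.mem_comap, mem_vanishingIdeal_singleton_iff]
  change aeval x (aeval (fun i => X i + C ((y - x) i)) f) = 0 ↔ _
  rw [← AlgHom.comp_apply, comp_aeval]
  simp

/-- The Krull dimension is the supremum of the heights of the maximal ideals. These are the ideals
of points, and translations give them all the same height. -/
theorem natCard_le_height_vanishingIdeal_singleton [Finite σ] (x : σ → ℂ) :
    (Nat.card σ : WithBot ℕ∞) ≤ (vanishingIdeal ℂ {x} : Ideal (MvPolynomial σ ℂ)).height := by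
  have h := MvPolynomial.ringKrullDim_of_isNoetherianRing (R := ℂ) (ι := σ)
  rw [ringKrullDim_eq_zero_of_field, zero_add, ← Ideal.sup_isMaximal_height_eq_ringKrullDim] at h
  rw [← h, WithBot.coe_le_coe]
  refine iSup₂_le fun I hI => ?_
  obtain ⟨y, rfl⟩ := (isMaximal_iff_eq_vanishingIdeal_singleton).1 hI
  exact (height_vanishingIdeal_singleton y x).le

theorem ringKrullDim_quotient_span_singleton [Finite σ] {f : MvPolynomial σ ℂ} (hf : f ≠ 0)
    {x : σ → ℂ} (hx : aeval x f = 0) {n : ℕ} (hn : Nat.card σ = n + 1) :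
    ringKrullDim (MvPolynomial σ ℂ ⧸ Ideal.span {f}) = n := by
  have h1 := ringKrullDim_quotient_succ_le_of_nonZeroDivisor (mem_nonZeroDivisors_of_ne_zero hf)
  have h2 := (natCard_le_height_vanishingIdeal_singleton x).trans
    (Ideal.height_le_ringKrullDim_quotient_add_one
      ((mem_vanishingIdeal_singleton_iff (k := ℂ) x f).2 hx))
  rw [MvPolynomial.ringKrullDim_of_isNoetherianRing, ringKrullDim_eq_zero_of_field, zero_add,
    hn] at h1
  rw [hn] at h2
  have h3 := h1.antisymm h2
  generalize ringKrullDim (MvPolynomial σ ℂ ⧸ Ideal.span {f}) = d at h3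
  cases d with
  | bot => exact absurd h3 (WithBot.bot_ne_coe (a := ((n + 1 : ℕ) : ℕ∞)))
  | coe a =>
    have h4 : a + 1 = (n : ℕ∞) + 1 := by exact_mod_cast h3
    have h5 : a = n := (ENat.add_left_injective_of_ne_top ENat.one_ne_top) h4
    rw [h5]
    rfl

variable [Fintype σ]

theorem mem_tangentSpace_iff_of_vanishingIdeal_eq {V : Set (σ → ℂ)} {f : MvPolynomial σ ℂ}
    (hV : vanishingIdeal ℂ V = Ideal.span {f}) {x : σ → ℂ} (hx : x ∈ V) {v : σ → ℂ} :
    v ∈ tangentSpace V x ↔ ∑ i, eval x (pderiv i f) * v i = 0 := by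
  have hf : f ∈ vanishingIdeal ℂ V := hV ▸ Ideal.mem_span_singleton_self f
  have hfx : eval x f = 0 := hf x hx
  refine ⟨fun h => h f hf, fun h g hg => ?_⟩
  rw [hV, Ideal.mem_span_singleton'] at hg
  obtain ⟨a, rfl⟩ := hg
  simp only [Derivation.leibniz, smul_eq_mul, map_add, map_mul, hfx, zero_mul, add_zero,
    mul_assoc, ← Finset.mul_sum, h, mul_zero]

/-- The tangent space is the kernel of a single functional, the gradient of `f`; its dimension is
`n` or `n + 1` according to whether this functional is nonzero. -/
theorem finrank_tangentSpace_ne_iff {V : Set (σ → ℂ)} {f : MvPolynomial σ ℂ}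
    (hV : vanishingIdeal ℂ V = Ideal.span {f}) {x : σ → ℂ} (hx : x ∈ V) {n : ℕ}
    (hn : Nat.card σ = n + 1) :
    Module.finrank ℂ (tangentSpace V x) ≠ n ↔ ∀ i, eval x (pderiv i f) = 0 := by
  classical
  let φ : (σ → ℂ) →ₗ[ℂ] ℂ := ∑ i, eval x (pderiv i f) • LinearMap.proj i
  have hφ : tangentSpace V x = LinearMap.ker φ := by
    ext v
    rw [mem_tangentSpace_iff_of_vanishingIdeal_eq hV hx]
    simp [φ]
  have hsum := φ.finrank_range_add_finrank_ker
  rw [Module.finrank_fintype_fun_eq_card, ← Nat.card_eq_fintype_card, hn] at hsum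
  rw [hφ]
  have hφ0 : φ = 0 ↔ ∀ i, eval x (pderiv i f) = 0 := by
    constructor
    · intro h i
      have := LinearMap.congr_fun h (Pi.single i 1)
      simpa [φ, Pi.single_apply] using this
    · intro h
      simp [φ, h]
  rw [← hφ0]
  constructor
  · intro h
    by_contra h0
    have := LinearMap.range_eq_top.2 (LinearMap.surjective h0)
    rw [this, finrank_top, Module.finrank_self] at hsum
    omega
  · rintro h
    rw [h, LinearMap.range_zero, finrank_bot] at hsum
    rw [h]
    omega

/-- The Jacobian criterion for an irreducible hypersurface. -/
theorem mem_singularLocus_iff_of_irreducible {V : Set (σ → ℂ)} {f : MvPolynomial σ ℂ}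
    (hf : Irreducible f) (hV : V = zeroLocus ℂ (Ideal.span {f})) {x : σ → ℂ} :
    x ∈ singularLocus V ↔ x ∈ V ∧ ∀ i, eval x (pderiv i f) = 0 := by
  have hprime : (Ideal.span {f}).IsPrime :=
    (Ideal.span_singleton_prime hf.ne_zero).2 hf.prime
  have hI : vanishingIdeal ℂ V = Ideal.span {f} := by
    rw [hV, IsPrime.vanishingIdeal_zeroLocus]
  have hirr : IsIrreducibleVariety V := hV ▸ isIrreducibleVariety_of_isPrime _
  refine and_congr_right fun hx => ?_
  have hfx : aeval x f = 0 := by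
    rw [hV] at hx
    exact hx f (Ideal.mem_span_singleton_self f)
  obtain ⟨n, hn⟩ : ∃ n, Nat.card σ = n + 1 := by
    refine Nat.exists_eq_succ_of_ne_zero fun h => ?_
    have : IsEmpty σ := Finite.card_eq_zero_iff.1 h
    rw [eq_C_of_isEmpty f] at hf hfx
    simp at hfx
    simp [hfx] at hf
  rw [localDimension_of_isIrreducibleVariety hirr hx, dimension, hI,
    ringKrullDim_quotient_span_singleton hf.ne_zero hfx hn, ← finrank_tangentSpace_ne_iff hI hx hn]
  norm_cast

end Hypersurface

/-! ### Singular points and degenerate configurations -/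

theorem aeval_volumePoly (l : Edge 4 → ℂ) : MvPolynomial.aeval l volumePoly =
    cayleyMenger (len l 0 1 ^ 2) (len l 0 2 ^ 2) (len l 0 3 ^ 2) (len l 1 2 ^ 2)
      (len l 1 3 ^ 2) (len l 2 3 ^ 2) := by
  have h := map_cayleyMenger (MvPolynomial.aeval (R := ℂ) l).toRingHom
  simp only [AlgHom.toRingHom_eq_coe, RingHom.coe_coe] at h
  rw [volumePoly, h]
  simp [len]

theorem L_eq_zeroLocus : L 2 4 = MvPolynomial.zeroLocus ℂ (Ideal.span {volumePoly}) := by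
  ext l
  rw [mem_L_iff, MvPolynomial.zeroLocus_span]
  simp only [Set.mem_singleton_iff, forall_eq, Set.mem_ofPred_eq, aeval_volumePoly]

theorem mem_singularLocus_L_iff {l : Edge 4 → ℂ} : l ∈ singularLocus (L 2 4) ↔
    l ∈ L 2 4 ∧ ∀ e, MvPolynomial.eval l (MvPolynomial.pderiv e volumePoly) = 0 :=
  mem_singularLocus_iff_of_irreducible irreducible_volumePoly L_eq_zeroLocus

/-- The lengths of a configuration on a line, up to signs. -/
def IsCollinear (l : Edge 4 → ℂ) : Prop :=
  ∃ q : Fin 4 → ℂ, ∀ i j, len l i j ^ 2 = (q i - q j) ^ 2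

/-- The lengths of a configuration with two coincident points, up to signs. -/
def HasTwins (l : Edge 4 → ℂ) : Prop :=
  ∃ i j : Fin 4, i ≠ j ∧ ∀ k, len l i k ^ 2 = len l j k ^ 2

/-- The three edges of some face have length zero. -/
def HasNullFace (l : Edge 4 → ℂ) : Prop :=
  ∃ i : Fin 4, ∀ j k, j ≠ i → k ≠ i → len l j k = 0

/-- The partial derivative of `cayleyMenger` with respect to its first argument. -/
def cayleyMengerDeriv {R : Type*} [CommRing R] (a b c d e f : R) : R :=
  4 * b * c + (a + c - e) * (b + c - f) + (a + b - d) * (b + c - f) - (b + c - f) ^ 2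
    - 2 * b * (a + c - e) - 2 * c * (a + b - d)

/-- The Cayley–Menger polynomial is symmetric in the four vertices, so relabelling moves any edge
into the first argument; the factor `2 * len l i j` is the chain rule for squaring. -/
theorem eval_pderiv_volumePoly (l : Edge 4 → ℂ) {i j k m : Fin 4} (hij : i < j) (hkm : k < m)
    (hnd : [i, j, k, m].Nodup) :
    MvPolynomial.eval l (MvPolynomial.pderiv ⟨(i, j), hij⟩ volumePoly) =
      2 * len l i j * cayleyMengerDeriv (len l i j ^ 2) (len l i k ^ 2) (len l i m ^ 2)
        (len l j k ^ 2) (len l j m ^ 2) (len l k m ^ 2) := by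
  have h4 : ∀ e : Edge 4, MvPolynomial.pderiv e (4 : MvPolynomial (Edge 4) ℂ) = 0 :=
    fun e => MvPolynomial.pderiv_C (a := (4 : ℂ))
  have hall : ∀ a b c d : Fin 4, a < b → c < d → [a, b, c, d].Nodup →
      (a, b, c, d) ∈ [((0 : Fin 4), (1 : Fin 4), (2 : Fin 4), (3 : Fin 4)), (0, 2, 1, 3),
        (0, 3, 1, 2), (1, 2, 0, 3), (1, 3, 0, 2), (2, 3, 0, 1)] := by
    decide
  have hmem := hall i j k m hij hkm hnd
  simp only [List.mem_cons, Prod.mk.injEq, List.not_mem_nil, or_false] at hmem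
  rcases hmem with ⟨rfl, rfl, rfl, rfl⟩ | ⟨rfl, rfl, rfl, rfl⟩ | ⟨rfl, rfl, rfl, rfl⟩ |
    ⟨rfl, rfl, rfl, rfl⟩ | ⟨rfl, rfl, rfl, rfl⟩ | ⟨rfl, rfl, rfl, rfl⟩
  all_goals
    simp [volumePoly, cayleyMenger, cayleyMengerDeriv, MvPolynomial.pderiv_X, len, h4]
    ring

theorem exists_nodup_of_edge (e : Edge 4) : ∃ k m, k < m ∧ [e.1.1, e.1.2, k, m].Nodup := by
  decide +revert

/-- Twice the signed area of a face of four points in the plane. -/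
def faceArea (p : Fin 4 → Fin 2 → ℂ) (i j k : Fin 4) : ℂ :=
  (p j 0 - p i 0) * (p k 1 - p i 1) - (p j 1 - p i 1) * (p k 0 - p i 0)

/-- The adjugate of a singular Gram matrix has rank at most one, which explains why this derivative
factors. -/
theorem cayleyMengerDeriv_planar (p : Fin 4 → Fin 2 → ℂ) (i j k m : Fin 4) :
    cayleyMengerDeriv (∑ t, (p i t - p j t) ^ 2) (∑ t, (p i t - p k t) ^ 2)
      (∑ t, (p i t - p m t) ^ 2) (∑ t, (p j t - p k t) ^ 2) (∑ t, (p j t - p m t) ^ 2)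
      (∑ t, (p k t - p m t) ^ 2) = 4 * faceArea p j k m * faceArea p i k m := by
  simp only [cayleyMengerDeriv, faceArea, Fin.sum_univ_two]
  ring

theorem isCollinear_of_faceArea {l : Edge 4 → ℂ} {p : Fin 4 → Fin 2 → ℂ}
    (hp : ∀ i j, len l i j ^ 2 = ∑ k, (p i k - p j k) ^ 2) (h : ∀ i j, faceArea p 0 i j = 0) :
    IsCollinear l := by
  obtain ⟨v, t, hv⟩ : ∃ (v : Fin 2 → ℂ) (t : Fin 4 → ℂ), ∀ i k, p i k - p 0 k = t i * v k := by
    by_cases h0 : ∀ i k, p i k = p 0 k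
    · exact ⟨0, 0, fun i k => by simp [h0 i k]⟩
    · push Not at h0
      obtain ⟨i, k, hik⟩ := h0
      have hne : p i k - p 0 k ≠ 0 := sub_ne_zero.2 hik
      refine ⟨fun k' => p i k' - p 0 k', fun j => (p j k - p 0 k) / (p i k - p 0 k),
        fun j k' => ?_⟩
      have hij := h i j
      rw [div_mul_eq_mul_div, eq_div_iff hne]
      simp only [faceArea] at hij
      fin_cases k <;> fin_cases k' <;> simp <;> grind
  -- The direction `v` may be isotropic; then `s = 0` and all the lengths vanish.
  obtain ⟨s, hs⟩ := IsAlgClosed.exists_pow_nat_eq (v 0 ^ 2 + v 1 ^ 2) zero_lt_two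
  refine ⟨fun i => t i * s, fun i j => ?_⟩
  rw [hp, Fin.sum_univ_two]
  have e : ∀ k, p i k - p j k = (t i - t j) * v k := fun k => by
    linear_combination hv i k - hv j k
  rw [e, e]
  linear_combination -(t i - t j) ^ 2 * hs

theorem exhaust_of_nodup {i j k m : Fin 4} (h : [i, j, k, m].Nodup) (a : Fin 4) :
    a = i ∨ a = j ∨ a = k ∨ a = m := by
  decide +revert

theorem hasNullFace_of_nodup {l : Edge 4 → ℂ} {i j k m : Fin 4} (h : [i, j, k, m].Nodup)
    (hjk : len l j k = 0) (hjm : len l j m = 0) (hkm : len l k m = 0) : HasNullFace l := by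
  refine ⟨i, fun a b ha hb => ?_⟩
  rcases exhaust_of_nodup h a with rfl | rfl | rfl | rfl <;>
    rcases exhaust_of_nodup h b with rfl | rfl | rfl | rfl <;>
    first | contradiction | exact len_self _ _ | assumption | (rw [len_comm]; assumption)

/-- The two nonzero faces share the edge `jk`, so `im` has length zero. If both other areas vanish,
`m` lies on the distinct lines `ij` and `ik`, hence equals `i`. Otherwise three nonzero faces share
a vertex, and each pair of them kills one side of the face opposite to that vertex. -/
theorem hasTwins_or_hasNullFace {l : Edge 4 → ℂ} {p : Fin 4 → Fin 2 → ℂ}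
    (hp : ∀ i j, len l i j ^ 2 = ∑ k, (p i k - p j k) ^ 2)
    (h : ∀ i j k m, [i, j, k, m].Nodup →
      len l i j * faceArea p j k m * faceArea p i k m = 0)
    {i j k m : Fin 4} (hnd : [i, j, k, m].Nodup) (h1 : faceArea p i j k ≠ 0)
    (h2 : faceArea p j k m ≠ 0) : HasTwins l ∨ HasNullFace l := by
  have hne : i ≠ j ∧ i ≠ k ∧ i ≠ m ∧ j ≠ k ∧ j ≠ m ∧ k ≠ m := by
    simpa [and_assoc] using hnd
  obtain ⟨n1, n2, n3, n4, n5, n6⟩ := hne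
  have cyc : ∀ {a b c}, faceArea p a b c ≠ 0 → faceArea p b c a ≠ 0 := fun {a b c} h => by
    rwa [show faceArea p b c a = faceArea p a b c by simp only [faceArea]; ring]
  have swp : ∀ {a b c}, faceArea p a b c ≠ 0 → faceArea p a c b ≠ 0 := fun {a b c} h => by
    rwa [show faceArea p a c b = -faceArea p a b c by simp only [faceArea]; ring, neg_ne_zero]
  have nd : ∀ a b c d : Fin 4, a ≠ b → a ≠ c → a ≠ d → b ≠ c → b ≠ d → c ≠ d →
      [a, b, c, d].Nodup := fun a b c d _ _ _ _ _ _ => by simp [*]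
  have len0 : ∀ {a b c d : Fin 4}, [a, b, c, d].Nodup → faceArea p b c d ≠ 0 →
      faceArea p a c d ≠ 0 → len l a b = 0 := fun {a b c d} hd h1 h2 =>
    (mul_eq_zero.1 ((mul_eq_zero.1 (h a b c d hd)).resolve_right h2)).resolve_right h1
  have him : len l i m = 0 :=
    len0 (nd _ _ _ _ n3 n1 n2 n5.symm n6.symm n4) (cyc (cyc h2)) h1
  by_cases h3 : faceArea p i k m = 0
  · by_cases h4 : faceArea p i j m = 0
    · left
      have key : ∀ t, p m t = p i t := by
        simp only [faceArea] at h1 h3 h4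
        intro t
        rw [← sub_eq_zero]
        refine (mul_eq_zero.1 ?_).resolve_left h1
        fin_cases t <;> simp <;> grind
      refine ⟨i, m, n3, fun t => ?_⟩
      rw [hp, hp]
      simp only [key]
    · exact Or.inr (hasNullFace_of_nodup (nd j i k m n1.symm n4 n5 n2 n3 n6)
        (len0 (nd _ _ _ _ n2 n1 n3 n4.symm n6 n5) (swp (cyc h2)) h4) him
        (len0 (nd _ _ _ _ n6 n2.symm n4.symm n3.symm n5.symm n1) (cyc (cyc h4)) (cyc (cyc h1))))
  · exact Or.inr (hasNullFace_of_nodup (nd k i j m n2.symm n4.symm n6 n1 n3 n5)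
      (len0 (nd _ _ _ _ n1 n2 n3 n4 n5 n6) h2 h3) him
      (len0 (nd _ _ _ _ n5 n1.symm n4 n3.symm n6.symm n2) (cyc (cyc h3)) (swp (cyc h1))))

/-- The singular points of `L_{2,4}`. -/
def IsDegenerate (l : Edge 4 → ℂ) : Prop := IsCollinear l ∨ HasTwins l ∨ HasNullFace l

theorem isDegenerate_of_mem_singularLocus {l : Edge 4 → ℂ} (hl : l ∈ singularLocus (L 2 4)) :
    IsDegenerate l := by
  obtain ⟨hL, hgrad⟩ := mem_singularLocus_L_iff.1 hl
  obtain ⟨p, hp⟩ := mem_L_iff_exists.1 hL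
  have swp : ∀ a b c, faceArea p a c b = -faceArea p a b c := fun a b c => by
    simp only [faceArea]; ring
  have h0 : ∀ i j k m, i < j → k < m → [i, j, k, m].Nodup →
      len l i j * faceArea p j k m * faceArea p i k m = 0 := fun i j k m hij hkm hnd => by
    have := hgrad ⟨(i, j), hij⟩
    rw [eval_pderiv_volumePoly l hij hkm hnd] at this
    simp only [hp, cayleyMengerDeriv_planar] at this
    linear_combination this / 8
  have h1 : ∀ i j k m, i < j → [i, j, k, m].Nodup →
      len l i j * faceArea p j k m * faceArea p i k m = 0 := fun i j k m hij hnd => by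
    rcases lt_trichotomy k m with hkm | rfl | hkm
    · exact h0 i j k m hij hkm hnd
    · simp at hnd
    · rw [swp j m k, swp i m k]
      linear_combination h0 i j m k hij hkm (by simp at hnd ⊢; grind)
  have h : ∀ i j k m, [i, j, k, m].Nodup →
      len l i j * faceArea p j k m * faceArea p i k m = 0 := fun i j k m hnd => by
    rcases lt_trichotomy i j with hij | rfl | hij
    · exact h1 i j k m hij hnd
    · simp at hnd
    · rw [len_comm]
      linear_combination h1 j i k m hij (by simp at hnd ⊢; grind)
  by_cases hz : ∀ i j, faceArea p 0 i j = 0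
  · exact Or.inl (isCollinear_of_faceArea hp hz)
  · right
    push Not at hz
    obtain ⟨i, j, hij⟩ := hz
    have hne : i ≠ 0 ∧ j ≠ 0 ∧ i ≠ j := by
      refine ⟨?_, ?_, ?_⟩ <;> rintro rfl <;> simp [faceArea, mul_comm] at hij
    obtain ⟨m, hm⟩ : ∃ m, [0, i, j, m].Nodup := by
      clear hij
      decide +revert
    -- This linear relation between the four areas excludes exactly one nonzero area.
    have hsum : faceArea p 0 i j = faceArea p i j m + faceArea p j 0 m + faceArea p 0 i m := by
      simp only [faceArea]; ring
    by_cases c1 : faceArea p i j m = 0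
    · by_cases c2 : faceArea p j 0 m = 0
      · refine hasTwins_or_hasNullFace hp h (i := j) (j := 0) (k := i) (m := m)
          (by simp at hm ⊢; grind) ?_ ?_
        · rwa [show faceArea p j 0 i = faceArea p 0 i j by simp only [faceArea]; ring]
        · rwa [hsum, c1, c2, zero_add, zero_add] at hij
      · refine hasTwins_or_hasNullFace hp h (i := i) (j := j) (k := 0) (m := m)
          (by simp at hm ⊢; grind) ?_ c2
        rwa [show faceArea p i j 0 = faceArea p 0 i j by simp only [faceArea]; ring]
    · exact hasTwins_or_hasNullFace hp h hm hij c1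

theorem mem_singularLocus_of_cayleyMenger {l : Edge 4 → ℂ}
    (h : cayleyMenger (len l 0 1 ^ 2) (len l 0 2 ^ 2) (len l 0 3 ^ 2) (len l 1 2 ^ 2)
      (len l 1 3 ^ 2) (len l 2 3 ^ 2) = 0)
    (h' : ∀ i j k m, [i, j, k, m].Nodup → len l i j * cayleyMengerDeriv (len l i j ^ 2)
      (len l i k ^ 2) (len l i m ^ 2) (len l j k ^ 2) (len l j m ^ 2) (len l k m ^ 2) = 0) :
    l ∈ singularLocus (L 2 4) := by
  refine mem_singularLocus_L_iff.2 ⟨mem_L_iff.2 h, fun e => ?_⟩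
  obtain ⟨k, m, hkm, hnd⟩ := exists_nodup_of_edge e
  rw [eval_pderiv_volumePoly l e.2 hkm hnd]
  linear_combination 2 * h' _ _ _ _ hnd

theorem IsCollinear.mem_singularLocus {l : Edge 4 → ℂ} (h : IsCollinear l) :
    l ∈ singularLocus (L 2 4) := by
  obtain ⟨q, hq⟩ := h
  refine mem_singularLocus_of_cayleyMenger ?_ fun i j k m _ => ?_
  · simp only [hq, cayleyMenger]; ring
  · simp only [hq, cayleyMengerDeriv]; ring

theorem HasTwins.mem_singularLocus {l : Edge 4 → ℂ} (h : HasTwins l) :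
    l ∈ singularLocus (L 2 4) := by
  obtain ⟨i, j, hij, h⟩ := h
  have key : ∀ a b c d, [a, b, c, d].Nodup →
      cayleyMenger (len l a b ^ 2) (len l a c ^ 2) (len l a d ^ 2) (len l b c ^ 2)
        (len l b d ^ 2) (len l c d ^ 2) = 0 ∧
      len l a b * cayleyMengerDeriv (len l a b ^ 2) (len l a c ^ 2) (len l a d ^ 2)
        (len l b c ^ 2) (len l b d ^ 2) (len l c d ^ 2) = 0 := by
    intro a b c d hnd
    have ha := h a
    have hb := h b
    have hc := h c
    have hd := h d
    have c1 := len_comm l b a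
    have c2 := len_comm l c a
    have c3 := len_comm l d a
    have c4 := len_comm l c b
    have c5 := len_comm l d b
    have c6 := len_comm l d c
    rcases exhaust_of_nodup hnd i with rfl | rfl | rfl | rfl <;>
      rcases exhaust_of_nodup hnd j with rfl | rfl | rfl | rfl <;>
      first
      | contradiction
      | clear h hnd
        simp only [c1, c2, c3, c4, c5, c6, len_self, cayleyMenger, cayleyMengerDeriv] at ha hb hc hd ⊢
        clear c1 c2 c3 c4 c5 c6
        constructor <;> grind
  exact mem_singularLocus_of_cayleyMenger (key 0 1 2 3 (by decide)).1
    fun a b c d hnd => (key a b c d hnd).2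

theorem HasNullFace.mem_singularLocus {l : Edge 4 → ℂ} (h : HasNullFace l) :
    l ∈ singularLocus (L 2 4) := by
  obtain ⟨i, h⟩ := h
  have key : ∀ a b c d, [a, b, c, d].Nodup →
      cayleyMenger (len l a b ^ 2) (len l a c ^ 2) (len l a d ^ 2) (len l b c ^ 2)
        (len l b d ^ 2) (len l c d ^ 2) = 0 ∧
      len l a b * cayleyMengerDeriv (len l a b ^ 2) (len l a c ^ 2) (len l a d ^ 2)
        (len l b c ^ 2) (len l b d ^ 2) (len l c d ^ 2) = 0 := by
    intro a b c d hnd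
    have hne : a ≠ b ∧ a ≠ c ∧ a ≠ d ∧ b ≠ c ∧ b ≠ d ∧ c ≠ d := by
      simpa [and_assoc] using hnd
    obtain ⟨n1, n2, n3, n4, n5, n6⟩ := hne
    rcases exhaust_of_nodup hnd i with rfl | rfl | rfl | rfl
    · rw [h b c n1.symm n2.symm, h b d n1.symm n3.symm, h c d n2.symm n3.symm]
      simp only [cayleyMenger, cayleyMengerDeriv]
      constructor <;> ring
    · rw [h a c n1 n4.symm, h a d n1 n5.symm, h c d n4.symm n5.symm]
      simp only [cayleyMenger, cayleyMengerDeriv]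
      constructor <;> ring
    · rw [h a b n2 n4, h a d n2 n6.symm, h b d n4 n6.symm]
      simp only [cayleyMenger, cayleyMengerDeriv]
      constructor <;> ring
    · rw [h a b n3 n5, h a c n3 n6, h b c n5 n6]
      simp only [cayleyMenger, cayleyMengerDeriv]
      constructor <;> ring
  exact mem_singularLocus_of_cayleyMenger (key 0 1 2 3 (by decide)).1
    fun a b c d hnd => (key a b c d hnd).2

theorem mem_singularLocus_iff_isDegenerate {l : Edge 4 → ℂ} :
    l ∈ singularLocus (L 2 4) ↔ IsDegenerate l :=
  ⟨isDegenerate_of_mem_singularLocus, fun h => h.elim IsCollinear.mem_singularLocus fun h =>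
    h.elim HasTwins.mem_singularLocus HasNullFace.mem_singularLocus⟩

/-! ### Volume zero with three free lengths -/

section Coefficients

/-- Three linear forms `u, v, w` in `x, y, z` completing `x, y, z` to the lengths of a tetrahedron
of volume zero, where `x, y, z` are the lengths of a face: the fourth point coincides with one of
the others. -/
theorem twin_of_face_free {u₁ u₂ u₃ v₁ v₂ v₃ w₁ w₂ w₃ : ℂ}
    (h : ∀ x y z : ℂ, cayleyMenger (x ^ 2) (y ^ 2) ((u₁ * x + u₂ * y + u₃ * z) ^ 2) (z ^ 2)
      ((v₁ * x + v₂ * y + v₃ * z) ^ 2) ((w₁ * x + w₂ * y + w₃ * z) ^ 2) = 0) :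
    (∀ x y z : ℂ, (u₁ * x + u₂ * y + u₃ * z) ^ 2 = 0 ∧ (v₁ * x + v₂ * y + v₃ * z) ^ 2 = x ^ 2 ∧
      (w₁ * x + w₂ * y + w₃ * z) ^ 2 = y ^ 2) ∨
    (∀ x y z : ℂ, (u₁ * x + u₂ * y + u₃ * z) ^ 2 = x ^ 2 ∧ (v₁ * x + v₂ * y + v₃ * z) ^ 2 = 0 ∧
      (w₁ * x + w₂ * y + w₃ * z) ^ 2 = z ^ 2) ∨
    (∀ x y z : ℂ, (u₁ * x + u₂ * y + u₃ * z) ^ 2 = y ^ 2 ∧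
      (v₁ * x + v₂ * y + v₃ * z) ^ 2 = z ^ 2 ∧ (w₁ * x + w₂ * y + w₃ * z) ^ 2 = 0) := by
  -- On the planes `z = ± x ± y` the volume is the negative of a square.
  have hE : ∀ t s : ℂ, t ^ 2 = 1 → s ^ 2 = 1 → ∀ x y : ℂ,
      (y - x) * (u₁ * x + u₂ * (t * y) + u₃ * (s * (x - y))) ^ 2
        - y * (v₁ * x + v₂ * (t * y) + v₃ * (s * (x - y))) ^ 2
        + x * (w₁ * x + w₂ * (t * y) + w₃ * (s * (x - y))) ^ 2 + x * y * (x - y) = 0 := by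
    intro t s ht hs x y
    have h1 := h x (t * y) (s * (x - y))
    generalize u₁ * x + u₂ * (t * y) + u₃ * (s * (x - y)) = U at h1 ⊢
    generalize v₁ * x + v₂ * (t * y) + v₃ * (s * (x - y)) = V at h1 ⊢
    generalize w₁ * x + w₂ * (t * y) + w₃ * (s * (x - y)) = Z at h1 ⊢
    rw [mul_pow, mul_pow, ht, hs] at h1
    rw [← sq_eq_zero_iff]
    simp only [cayleyMenger] at h1
    linear_combination -h1
  have o : (1 : ℂ) ^ 2 = 1 := by norm_num
  have n : (-1 : ℂ) ^ 2 = 1 := by norm_num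
  -- Combining samples over the signs `t`, `s` separates mixed products from squares. It follows
  -- that the three squared forms have the same mixed terms, so they differ by diagonal quadratic
  -- forms.
  have a1 := hE 1 1 o o 1 0
  have a2 := hE 1 (-1) o n 1 0
  have b1 := hE 1 1 o o 0 1
  have b2 := hE 1 (-1) o n 0 1
  have c1 := hE 1 1 o o 1 1
  have c3 := hE (-1) 1 n o 1 1
  have d1 := hE 1 1 o o 1 (-1)
  have d2 := hE 1 (-1) o n 1 (-1)
  have d3 := hE (-1) 1 n o 1 (-1)
  have d4 := hE (-1) (-1) n n 1 (-1)
  have uw13 : w₁ * w₃ = u₁ * u₃ := by linear_combination (a1 - a2) / 4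
  have uv23 : v₂ * v₃ = u₂ * u₃ := by linear_combination (b1 - b2) / 4
  have vw12 : v₁ * v₂ = w₁ * w₂ := by linear_combination (c3 - c1) / 4
  have uv13 : v₁ * v₃ = u₁ * u₃ := by
    linear_combination (d1 - d2 + d3 - d4) / 16 - uw13
  have uw12 : w₁ * w₂ = u₁ * u₂ := by
    linear_combination (- d1 - d2 + d3 + d4) / 16 - vw12 / 2
  have uv12 : v₁ * v₂ = u₁ * u₂ := vw12.trans uw12
  have uw23 : w₂ * w₃ = u₂ * u₃ := by
    linear_combination (- d1 + d2 + d3 - d4) / 16 - uv23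
  have p1 : u₁ ^ 2 + u₃ ^ 2 = w₁ ^ 2 + w₃ ^ 2 := by linear_combination -(a1 + a2) / 2
  have p2 : u₂ ^ 2 + u₃ ^ 2 = v₂ ^ 2 + v₃ ^ 2 := by linear_combination (b1 + b2) / 2
  have p3 : v₁ ^ 2 + v₂ ^ 2 = w₁ ^ 2 + w₂ ^ 2 := by linear_combination -(c1 + c3) / 2
  have p4 : 2 * (u₁ ^ 2 + u₂ ^ 2 + 4 * u₃ ^ 2) + 2 =
      v₁ ^ 2 + v₂ ^ 2 + 4 * v₃ ^ 2 + (w₁ ^ 2 + w₂ ^ 2 + 4 * w₃ ^ 2) := by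
    linear_combination -(d1 + d2 + d3 + d4) / 4
  clear hE a1 a2 b1 b2 c1 c3 d1 d2 d3 d4 vw12
  -- The barycentric coordinates of the fourth point are constant.
  obtain ⟨β, hβ⟩ : ∃ β, β = u₁ ^ 2 - w₁ ^ 2 := ⟨_, rfl⟩
  obtain ⟨γ, hγ⟩ : ∃ γ, γ = u₂ ^ 2 - v₂ ^ 2 := ⟨_, rfl⟩
  obtain ⟨α, hα⟩ : ∃ α, α = 1 - β - γ := ⟨_, rfl⟩
  have V1 : v₁ ^ 2 = u₁ ^ 2 + (α - β) := by grind
  have V2 : v₂ ^ 2 = u₂ ^ 2 - γ := by grind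
  have V3 : v₃ ^ 2 = u₃ ^ 2 + γ := by grind
  have W1 : w₁ ^ 2 = u₁ ^ 2 - β := by grind
  have W2 : w₂ ^ 2 = u₂ ^ 2 + (α - γ) := by grind
  have W3 : w₃ ^ 2 = u₃ ^ 2 + β := by grind
  have hV : ∀ x y z, (v₁ * x + v₂ * y + v₃ * z) ^ 2 = (u₁ * x + u₂ * y + u₃ * z) ^ 2
      + (α - β) * x ^ 2 - γ * y ^ 2 + γ * z ^ 2 := fun x y z => by
    linear_combination x ^ 2 * V1 + y ^ 2 * V2 + z ^ 2 * V3 + 2 * x * y * uv12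
      + 2 * x * z * uv13 + 2 * y * z * uv23
  have hW : ∀ x y z, (w₁ * x + w₂ * y + w₃ * z) ^ 2 = (u₁ * x + u₂ * y + u₃ * z) ^ 2
      - β * x ^ 2 + (α - γ) * y ^ 2 + β * z ^ 2 := fun x y z => by
    linear_combination x ^ 2 * W1 + y ^ 2 * W2 + z ^ 2 * W3 + 2 * x * y * uw12
      + 2 * x * z * uw13 + 2 * y * z * uw23
  -- The first factor is Heron's product for the face `x, y, z`. It is nonzero at the six points
  -- sampled below, so the quadratic factor vanishes there and hence identically.
  have hU : ∀ x y z, ((x + y + z) * (-x + y + z) * (x - y + z) * (x + y - z)) *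
      ((u₁ * x + u₂ * y + u₃ * z) ^ 2 - β * (β + γ) * x ^ 2 - γ * (β + γ) * y ^ 2
        + β * γ * z ^ 2) = 0 := fun x y z => by
    have h1 := h x y z
    rw [hV, hW, hα] at h1
    simp only [cayleyMenger] at h1
    linear_combination h1
  have q1 := hU 1 0 0
  have q2 := hU 0 1 0
  have q3 := hU 0 0 1
  have q4 := hU 1 1 1
  have q5 := hU 1 1 (-1)
  have q6 := hU 1 (-1) 1
  have U1 : u₁ ^ 2 = β * (1 - α) := by rw [hα]; linear_combination -q1
  have U2 : u₂ ^ 2 = γ * (1 - α) := by rw [hα]; linear_combination -q2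
  have U3 : u₃ ^ 2 = -β * γ := by linear_combination -q3
  have u12 : u₁ * u₂ = 0 := by linear_combination (q4 + q5) / 12 + q1 / 2 + q2 / 2 + q3 / 2
  have u13 : u₁ * u₃ = 0 := by linear_combination (q4 + q6) / 12 + q1 / 2 + q2 / 2 + q3 / 2
  have u23 : u₂ * u₃ = 0 := by linear_combination -(q5 + q6) / 12 - q1 / 2 - q2 / 2 - q3 / 2
  clear hU q1 q2 q3 q4 q5 q6 p1 p2 p3 p4 hβ hγ h
  have quad : ∀ x y z, (u₁ * x + u₂ * y + u₃ * z) ^ 2 =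
      β * (1 - α) * x ^ 2 + γ * (1 - α) * y ^ 2 - β * γ * z ^ 2 := fun x y z => by
    linear_combination x ^ 2 * U1 + y ^ 2 * U2 + z ^ 2 * U3 + 2 * x * y * u12
      + 2 * x * z * u13 + 2 * y * z * u23
  -- The squares of `u`, `v`, `w` are now diagonal, so in each the product of the first two
  -- coefficients is zero. With `α + β + γ = 1` this leaves one barycentric coordinate equal to 1
  -- and the others 0.
  have k1 : β * γ * (1 - α) ^ 2 = 0 := by
    linear_combination u₁ * u₂ * u12 - U1 * u₂ ^ 2 - β * (1 - α) * U2
  have k2 : α * γ * (α * (1 - β)) = 0 := by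
    linear_combination -v₁ * v₂ * (uv12 + u12) + v₂ ^ 2 * (V1 + U1) + α * (1 - β) * (V2 + U2)
  have k3 : α * β * (α * (1 - γ)) = 0 := by
    linear_combination -w₁ * w₂ * (uw12 + u12) + w₂ ^ 2 * (W1 + U1) - α * β * (W2 + U2)
  have hβγ : β * γ = 0 := by
    by_contra hne
    obtain ⟨hβ, hγ⟩ := mul_ne_zero_iff.1 hne
    have hα1 : α = 1 := by
      have := (mul_eq_zero.1 k1).resolve_left hne
      linear_combination -(sq_eq_zero_iff.1 this)
    subst hα1
    have h1 : 1 - β = 0 := by simpa [hγ] using k2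
    have h2 : 1 - γ = 0 := by simpa [hβ] using k3
    have : (2 : ℂ) = 0 := by linear_combination hα + h1 + h2
    exact two_ne_zero this
  have hαγ : α * γ = 0 := by
    by_contra hne
    obtain ⟨hα', hγ⟩ := mul_ne_zero_iff.1 hne
    have hβ : β = 0 := (mul_eq_zero.1 hβγ).resolve_right hγ
    simp [hβ, hα', hγ] at k2
  have hαβ : α * β = 0 := by
    by_contra hne
    obtain ⟨hα', hβ⟩ := mul_ne_zero_iff.1 hne
    have hγ : γ = 0 := (mul_eq_zero.1 hβγ).resolve_left hβ
    simp [hγ, hα', hβ] at k3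
  simp only [hV, hW, quad]
  rcases eq_or_ne β 0 with hβ | hβ
  · rcases eq_or_ne γ 0 with hγ | hγ
    · left
      have hα' : α = 1 := by rw [hα, hβ, hγ]; ring
      intro x y z
      rw [hα', hβ, hγ]
      refine ⟨?_, ?_, ?_⟩ <;> ring
    · right; right
      have hα' : α = 0 := (mul_eq_zero.1 hαγ).resolve_right hγ
      have hγ' : γ = 1 := by linear_combination hα - hβ - hα'
      intro x y z
      rw [hα', hβ, hγ']
      refine ⟨?_, ?_, ?_⟩ <;> ring
  · right; left
    have hα' : α = 0 := (mul_eq_zero.1 hαβ).resolve_right hβ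
    have hγ : γ = 0 := (mul_eq_zero.1 hβγ).resolve_left hβ
    have hβ' : β = 1 := by linear_combination hα - hγ - hα'
    intro x y z
    rw [hα', hβ', hγ]
    refine ⟨?_, ?_, ?_⟩ <;> ring

/-- Lengths of the faces at a vertex whose three edges have free lengths `x, y, z`. -/
theorem star_free {α β γ δ ε ζ : ℂ}
    (h : ∀ x y z : ℂ, cayleyMenger (x ^ 2) (y ^ 2) (z ^ 2) ((α * x + β * y) ^ 2)
      ((γ * x + δ * z) ^ 2) ((ε * y + ζ * z) ^ 2) = 0) :
    (α = 0 ∧ β = 0 ∧ γ = 0 ∧ δ = 0 ∧ ε = 0 ∧ ζ = 0) ∨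
    (α ^ 2 = 1 ∧ β ^ 2 = 1 ∧ γ ^ 2 = 1 ∧ δ ^ 2 = 1 ∧ ε ^ 2 = 1 ∧ ζ ^ 2 = 1 ∧
      α * β * γ * δ * ε * ζ = -1) := by
  simp only [cayleyMenger] at h
  have z1 := h 1 1 0
  have z2 := h 1 (-1) 0
  have z3 := h 2 1 0
  have y1 := h 1 0 1
  have y2 := h 1 0 (-1)
  have y3 := h 2 0 1
  have x1 := h 0 1 1
  have x2 := h 0 1 (-1)
  have x3 := h 0 2 1
  have e := h 1 1 1
  clear h
  obtain ⟨a, ha⟩ : ∃ a, a = 1 - α ^ 2 := ⟨_, rfl⟩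
  obtain ⟨b, hb⟩ : ∃ b, b = 1 - β ^ 2 := ⟨_, rfl⟩
  obtain ⟨c, hc⟩ : ∃ c, c = 1 - γ ^ 2 := ⟨_, rfl⟩
  obtain ⟨d, hd⟩ : ∃ d, d = 1 - δ ^ 2 := ⟨_, rfl⟩
  obtain ⟨r, hr⟩ : ∃ r, r = 1 - ε ^ 2 := ⟨_, rfl⟩
  obtain ⟨s, hs⟩ : ∃ s, s = 1 - ζ ^ 2 := ⟨_, rfl⟩
  -- For `z = 0` the volume is `x ^ 2 * y ^ 2` times a binary quadratic form whose three
  -- coefficients are `E1`, `E2`, `E3`. The planes `y = 0` and `x = 0` give the other two triples.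
  have E1 : a * c * r = c ^ 2 := by
    rw [ha, hc, hr]; linear_combination z3 / 12 - z1 / 2 + z2 / 6
  have E2 : α * β * (c * r) = 0 := by rw [hc, hr]; linear_combination (z2 - z1) / 4
  have E3 : b * c * r = r ^ 2 := by
    rw [hb, hc, hr]; linear_combination (z1 + z2) / 2 - (z3 / 12 - z1 / 2 + z2 / 6)
  have E4 : c * a * s = a ^ 2 := by
    rw [ha, hc, hs]; linear_combination y3 / 12 - y1 / 2 + y2 / 6
  have E5 : γ * δ * (a * s) = 0 := by rw [ha, hs]; linear_combination (y2 - y1) / 4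
  have E6 : d * a * s = s ^ 2 := by
    rw [hd, ha, hs]; linear_combination (y1 + y2) / 2 - (y3 / 12 - y1 / 2 + y2 / 6)
  have E7 : r * b * d = b ^ 2 := by
    rw [hb, hd, hr]; linear_combination x3 / 12 - x1 / 2 + x2 / 6
  have E8 : ε * ζ * (b * d) = 0 := by rw [hb, hd]; linear_combination (x2 - x1) / 4
  have E9 : s * b * d = d ^ 2 := by
    rw [hb, hd, hs]; linear_combination (x1 + x2) / 2 - (x3 / 12 - x1 / 2 + x2 / 6)
  clear z1 z2 z3 y1 y2 y3 x1 x2 x3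
  by_cases hc0 : c = 0
  · right
    have hr0 : r = 0 := by simpa [hc0] using E3.symm
    have hb0 : b = 0 := by simpa [hr0] using E7.symm
    have hd0 : d = 0 := by simpa [hb0] using E9.symm
    have ha0 : a = 0 := by simpa [hc0] using E4.symm
    have hs0 : s = 0 := by simpa [hd0] using E6.symm
    rw [ha0] at ha
    rw [hb0] at hb
    rw [hc0] at hc
    rw [hd0] at hd
    rw [hr0] at hr
    rw [hs0] at hs
    have qa : α ^ 2 = 1 := by linear_combination ha
    have qb : β ^ 2 = 1 := by linear_combination hb
    have qc : γ ^ 2 = 1 := by linear_combination hc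
    have qd : δ ^ 2 = 1 := by linear_combination hd
    have qr : ε ^ 2 = 1 := by linear_combination hr
    have qs : ζ ^ 2 = 1 := by linear_combination hs
    refine ⟨qa, qb, qc, qd, qr, qs, ?_⟩
    -- The product of the six signs is read off from the value at `(1, 1, 1)`; the coordinate planes
    -- do not determine it.
    have f1 : (α * 1 + β * 1) ^ 2 = 2 + 2 * (α * β) := by linear_combination qa + qb
    have f2 : (γ * 1 + δ * 1) ^ 2 = 2 + 2 * (γ * δ) := by linear_combination qc + qd
    have f3 : (ε * 1 + ζ * 1) ^ 2 = 2 + 2 * (ε * ζ) := by linear_combination qr + qs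
    have g1 : (α * β) ^ 2 = 1 := by rw [mul_pow, qa, qb, one_mul]
    have g2 : (γ * δ) ^ 2 = 1 := by rw [mul_pow, qc, qd, one_mul]
    have g3 : (ε * ζ) ^ 2 = 1 := by rw [mul_pow, qr, qs, one_mul]
    rw [f1, f2, f3] at e
    linear_combination -e / 8 - g1 / 2 - g2 / 2 - g3 / 2
  · left
    have F1 : a * r = c := mul_right_cancel₀ hc0 (by linear_combination E1)
    have hr0 : r ≠ 0 := fun h0 => hc0 (by rw [← F1, h0, mul_zero])
    have ha0 : a ≠ 0 := fun h0 => hc0 (by rw [← F1, h0, zero_mul])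
    have F3 : b * c = r := mul_right_cancel₀ hr0 (by linear_combination E3)
    have hb0 : b ≠ 0 := fun h0 => hr0 (by rw [← F3, h0, zero_mul])
    have F4 : c * s = a := mul_right_cancel₀ ha0 (by linear_combination E4)
    have hs0 : s ≠ 0 := fun h0 => ha0 (by rw [← F4, h0, mul_zero])
    have F6 : d * a = s := mul_right_cancel₀ hs0 (by linear_combination E6)
    have hd0 : d ≠ 0 := fun h0 => hs0 (by rw [← F6, h0, zero_mul])
    have G1 : α * β = 0 := by simpa [hc0, hr0] using E2
    have G2 : γ * δ = 0 := by simpa [ha0, hs0] using E5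
    have hab : a = 1 ∧ b = 1 := by
      rcases mul_eq_zero.1 G1 with h0 | h0
      · have ha1 : a = 1 := by rw [ha, h0]; ring
        rw [ha1, one_mul] at F1
        exact ⟨ha1, mul_right_cancel₀ hc0 (by rw [F3, F1, one_mul])⟩
      · have hb1 : b = 1 := by rw [hb, h0]; ring
        rw [hb1, one_mul] at F3
        exact ⟨mul_right_cancel₀ hr0 (by rw [F1, F3, one_mul]), hb1⟩
    obtain ⟨ha1, hb1⟩ := hab
    rw [ha1] at F1 F4 F6
    have hcd : c = 1 ∧ d = 1 := by
      rcases mul_eq_zero.1 G2 with h0 | h0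
      · have hc1 : c = 1 := by rw [hc, h0]; ring
        rw [hc1, one_mul] at F4
        exact ⟨hc1, by linear_combination F6 + F4⟩
      · have hd1 : d = 1 := by rw [hd, h0]; ring
        have hs1 : s = 1 := by linear_combination -F6 + hd1
        exact ⟨by linear_combination F4 - c * hs1, hd1⟩
    obtain ⟨hc1, hd1⟩ := hcd
    have hr1 : r = 1 := by linear_combination F1 + hc1
    have hs1 : s = 1 := by linear_combination -F6 + hd1
    refine ⟨?_, ?_, ?_, ?_, ?_, ?_⟩ <;> rw [← sq_eq_zero_iff]
    · linear_combination ha - ha1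
    · linear_combination hb - hb1
    · linear_combination hc - hc1
    · linear_combination hd - hd1
    · linear_combination hr - hr1
    · linear_combination hs - hs1

/-- There is no tetrahedron of volume zero with free lengths `x, y, z` along a path. -/
theorem path_not_free {β γ ε ζ η : ℂ}
    (h : ∀ x y z : ℂ, cayleyMenger (x ^ 2) ((β * y) ^ 2) ((ε * x + ζ * y + η * z) ^ 2) (y ^ 2)
      ((γ * y) ^ 2) (z ^ 2) = 0) : False := by
  simp only [cayleyMenger] at h
  -- For `y = 0` the volume is `x ^ 2 * z ^ 2 * ((ε * x + η * z) ^ 2 - x ^ 2 - z ^ 2)`, and `x ^ 2 +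
  -- z ^ 2` is not the square of a linear form.
  have h1 := h 1 0 1
  have h2 := h 1 0 (-1)
  have h3 := h 2 0 1
  have k1 : ε * η = 0 := by linear_combination (h1 - h2) / 4
  have k2 : ε ^ 2 + η ^ 2 = 2 := by linear_combination (h1 + h2) / 2
  have k3 : ε ^ 2 = 1 := by linear_combination h3 / 12 - k2 / 3 - 4 / 3 * k1
  have k4 : η ^ 2 = 1 := by linear_combination k2 - k3
  have : (1 : ℂ) = 0 := by linear_combination ε * η * k1 - η ^ 2 * k3 - k4
  exact one_ne_zero this

end Coefficients

/-! ### Three-dimensional subspaces in length coordinates -/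

/-- `len` as a linear form on the space of edge lengths. -/
def lenForm {n : ℕ} (i j : Fin n) : (Edge n → ℂ) →ₗ[ℂ] ℂ where
  toFun l := len l i j
  map_add' l l' := by
    unfold len
    split_ifs <;> simp
  map_smul' c l := by
    unfold len
    split_ifs <;> simp

theorem lenForm_apply {n : ℕ} (i j : Fin n) (l : Edge n → ℂ) : lenForm i j l = len l i j := rfl

theorem len_combination {n : ℕ} (a b c : Edge n → ℂ) (x y z : ℂ) (i j : Fin n) :
    len (x • a + y • b + z • c) i j =
      lenForm i j a * x + lenForm i j b * y + lenForm i j c * z := by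
  rw [← lenForm_apply]
  simp only [map_add, map_smul, smul_eq_mul]
  ring

/-- Three linear forms have no common zero on `W` but the origin. -/
def Separates {V : Type*} [AddCommGroup V] [Module ℂ V] (W : Submodule ℂ V)
    (f g h : V →ₗ[ℂ] ℂ) : Prop :=
  ∀ l ∈ W, f l = 0 → g l = 0 → h l = 0 → l = 0

/-- The dual basis turns the three separating lengths into free variables and every other length
into a linear form in them. -/
theorem Separates.exists_dual {V : Type*} [AddCommGroup V] [Module ℂ V] {W : Submodule ℂ V}
    {f g h : V →ₗ[ℂ] ℂ} (hs : Separates W f g h) (hW : Module.finrank ℂ W = 3) :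
    ∃ a ∈ W, ∃ b ∈ W, ∃ c ∈ W, (f a = 1 ∧ g a = 0 ∧ h a = 0) ∧ (f b = 0 ∧ g b = 1 ∧ h b = 0) ∧
      (f c = 0 ∧ g c = 0 ∧ h c = 1) ∧ ∀ l ∈ W, l = f l • a + g l • b + h l • c := by
  have : FiniteDimensional ℂ W := Module.finite_of_finrank_pos (by omega)
  let Φ : W →ₗ[ℂ] (Fin 3 → ℂ) := LinearMap.pi ![f, g, h] ∘ₗ W.subtype
  have hinj : Function.Injective Φ := by
    rw [← LinearMap.ker_eq_bot, LinearMap.ker_eq_bot']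
    intro l hl
    exact Subtype.ext (hs l l.2 (congrFun hl 0) (congrFun hl 1) (congrFun hl 2))
  have hsurj : Function.Surjective Φ :=
    (LinearMap.injective_iff_surjective_of_finrank_eq_finrank (by simp [hW])).1 hinj
  obtain ⟨a, ha⟩ := hsurj ![1, 0, 0]
  obtain ⟨b, hb⟩ := hsurj ![0, 1, 0]
  obtain ⟨c, hc⟩ := hsurj ![0, 0, 1]
  have a0 : f a = 1 := congrFun ha 0
  have a1 : g a = 0 := congrFun ha 1
  have a2 : h a = 0 := congrFun ha 2
  have b0 : f b = 0 := congrFun hb 0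
  have b1 : g b = 1 := congrFun hb 1
  have b2 : h b = 0 := congrFun hb 2
  have c0 : f c = 0 := congrFun hc 0
  have c1 : g c = 0 := congrFun hc 1
  have c2 : h c = 1 := congrFun hc 2
  refine ⟨a, a.2, b, b.2, c, c.2, ⟨a0, a1, a2⟩, ⟨b0, b1, b2⟩, ⟨c0, c1, c2⟩, fun l hl => ?_⟩
  rw [← sub_eq_zero]
  refine hs _ (W.sub_mem hl (W.add_mem (W.add_mem (W.smul_mem _ a.2) (W.smul_mem _ b.2))
    (W.smul_mem _ c.2))) ?_ ?_ ?_ <;> simp [a0, a1, a2, b0, b1, b2, c0, c1, c2]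

/-- A three-dimensional space of functions is separated by three of the coordinates. -/
theorem exists_separates_proj {ι : Type*} [Finite ι] (W : Submodule ℂ (ι → ℂ))
    (hW : Module.finrank ℂ W = 3) : ∃ e : Fin 3 → ι, Function.Injective e ∧
      ∀ l ∈ W, (∀ r, l (e r) = 0) → l = 0 := by
  -- A maximal independent family among the restricted coordinates spans them all, so it separates
  -- `W`; it has exactly three members.
  obtain ⟨κ, a, ha, hspan, hli⟩ :=
    exists_linearIndependent' ℂ (fun i : ι => (LinearMap.proj i : (ι → ℂ) →ₗ[ℂ] ℂ) ∘ₗ W.subtype)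
  have hfin : Finite κ := Finite.of_injective a ha
  have := Fintype.ofFinite κ
  have hsep : ∀ l ∈ W, (∀ k, l (a k) = 0) → l = 0 := by
    intro l hl hk
    funext i
    let ev : Module.Dual ℂ W →ₗ[ℂ] ℂ := Module.Dual.eval ℂ W ⟨l, hl⟩
    have h1 : Submodule.span ℂ (Set.range ((fun i : ι =>
        (LinearMap.proj i : (ι → ℂ) →ₗ[ℂ] ℂ) ∘ₗ W.subtype) ∘ a)) ≤ LinearMap.ker ev := by
      rw [Submodule.span_le]
      rintro _ ⟨k, rfl⟩
      exact hk k
    rw [hspan] at h1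
    exact h1 (Submodule.subset_span ⟨i, rfl⟩)
  have hle : Fintype.card κ ≤ 3 := by
    have := hli.fintype_card_le_finrank
    rwa [show Module.finrank ℂ (W →ₗ[ℂ] ℂ) = Module.finrank ℂ W from
      Subspace.dual_finrank_eq, hW] at this
  have hge : 3 ≤ Fintype.card κ := by
    let Φ : W →ₗ[ℂ] (κ → ℂ) :=
      LinearMap.pi (fun k => (LinearMap.proj (a k) : (ι → ℂ) →ₗ[ℂ] ℂ) ∘ₗ W.subtype)
    have hinj : Function.Injective Φ := by
      rw [← LinearMap.ker_eq_bot, LinearMap.ker_eq_bot']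
      intro l hl
      exact Subtype.ext (hsep l l.2 fun k => congrFun hl k)
    have := LinearMap.finrank_le_finrank_of_injective hinj
    simpa [hW] using this
  let σ := Fintype.equivFinOfCardEq (le_antisymm hle hge)
  refine ⟨a ∘ σ.symm, ha.comp σ.symm.injective, fun l hl h => hsep l hl fun k => ?_⟩
  simpa using h (σ k)

/-- The edge joining two vertices. -/
def Joins (e : Edge 4) (i j : Fin 4) : Prop := e.1 = (i, j) ∨ e.1 = (j, i)

instance (e : Edge 4) (i j : Fin 4) : Decidable (Joins e i j) :=
  inferInstanceAs (Decidable (_ ∨ _))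

theorem Joins.eq_zero {e : Edge 4} {i j : Fin 4} (h : Joins e i j) {l : Edge 4 → ℂ}
    (hl : len l i j = 0) : l e = 0 := by
  rw [← len_edge l e]
  rcases h with h | h
  · rw [h]; exact hl
  · rw [h, len_comm]; exact hl

set_option synthInstance.maxSize 1000 in
/-- Three edges of the complete graph on four vertices form a triangle, a star or a path. -/
theorem triangle_or_star_or_path : ∀ e₀ e₁ e₂ : Edge 4, e₀ ≠ e₁ → e₀ ≠ e₂ → e₁ ≠ e₂ →
    ∃ i j k m, [i, j, k, m].Nodup ∧
      ((∀ e ∈ [e₀, e₁, e₂], Joins e i j ∨ Joins e i k ∨ Joins e j k) ∨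
       (∀ e ∈ [e₀, e₁, e₂], Joins e i j ∨ Joins e i k ∨ Joins e i m) ∨
       (∀ e ∈ [e₀, e₁, e₂], Joins e i j ∨ Joins e j k ∨ Joins e k m)) := by
  decide +kernel

theorem exists_separates_len {W : Submodule ℂ (Edge 4 → ℂ)} (hW : Module.finrank ℂ W = 3) :
    ∃ i j k m, [i, j, k, m].Nodup ∧
      (Separates W (lenForm i j) (lenForm i k) (lenForm j k) ∨
       Separates W (lenForm i j) (lenForm i k) (lenForm i m) ∨
       Separates W (lenForm i j) (lenForm j k) (lenForm k m)) := by
  obtain ⟨e, he, hsep⟩ := exists_separates_proj W hW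
  obtain ⟨i, j, k, m, hnd, h⟩ := triangle_or_star_or_path (e 0) (e 1) (e 2)
    (he.ne (by decide)) (he.ne (by decide)) (he.ne (by decide))
  have hmem : ∀ r, e r ∈ [e 0, e 1, e 2] := by
    intro r
    fin_cases r <;> simp
  refine ⟨i, j, k, m, hnd, h.imp ?_ (Or.imp ?_ ?_)⟩
  all_goals
    intro h l hl h1 h2 h3
    refine hsep l hl fun r => ?_
    rcases h (e r) (hmem r) with h | h | h
    exacts [h.eq_zero h1, h.eq_zero h2, h.eq_zero h3]

theorem hasTwins_of_nodup {l : Edge 4 → ℂ} {i j k m : Fin 4} (hnd : [i, j, k, m].Nodup)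
    (h0 : len l i j ^ 2 = 0) (hk : len l i k ^ 2 = len l j k ^ 2)
    (hm : len l i m ^ 2 = len l j m ^ 2) : HasTwins l := by
  refine ⟨i, j, by rintro rfl; simp at hnd, fun t => ?_⟩
  rcases exhaust_of_nodup hnd t with rfl | rfl | rfl | rfl
  · rw [len_comm l j, h0, len_self]; ring
  · rw [h0, len_self]; ring
  · exact hk
  · exact hm

theorem isCollinear_of_nodup {l : Edge 4 → ℂ} {i j k m : Fin 4} (hnd : [i, j, k, m].Nodup)
    (a b c d : ℂ) (hij : len l i j ^ 2 = (a - b) ^ 2) (hik : len l i k ^ 2 = (a - c) ^ 2)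
    (him : len l i m ^ 2 = (a - d) ^ 2) (hjk : len l j k ^ 2 = (b - c) ^ 2)
    (hjm : len l j m ^ 2 = (b - d) ^ 2) (hkm : len l k m ^ 2 = (c - d) ^ 2) : IsCollinear l := by
  obtain ⟨q, rfl, rfl, rfl, rfl⟩ : ∃ q : Fin 4 → ℂ, q i = a ∧ q j = b ∧ q k = c ∧ q m = d := by
    refine ⟨fun t => if t = i then a else if t = j then b else if t = k then c else d, ?_⟩
    simp only [List.nodup_cons, List.mem_cons, List.not_mem_nil, not_or, or_false] at hnd
    grind
  refine ⟨q, fun s t => ?_⟩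
  rcases exhaust_of_nodup hnd s with rfl | rfl | rfl | rfl <;>
    rcases exhaust_of_nodup hnd t with rfl | rfl | rfl | rfl <;>
    first | assumption | (rw [len_self]; ring) | (rw [len_comm, sub_sq_comm]; assumption)

section Subspace

variable {W : Submodule ℂ (Edge 4 → ℂ)}

theorem hasTwins_of_separates_triangle (hW : Module.finrank ℂ W = 3)
    (hL : (W : Set (Edge 4 → ℂ)) ⊆ L 2 4) {i j k m : Fin 4} (hnd : [i, j, k, m].Nodup)
    (hs : Separates W (lenForm i j) (lenForm i k) (lenForm j k)) {l : Edge 4 → ℂ} (hl : l ∈ W) :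
    HasTwins l := by
  obtain ⟨a, ha, b, hb, c, hc, ⟨a1, a2, a3⟩, ⟨b1, b2, b3⟩, ⟨c1, c2, c3⟩, hspan⟩ :=
    hs.exists_dual hW
  have expand := len_combination a b c
  have hCM : ∀ x y z : ℂ, _ := fun x y z => cayleyMenger_len_eq_zero
    (hL (W.add_mem (W.add_mem (W.smul_mem x ha) (W.smul_mem y hb)) (W.smul_mem z hc))) i j k m
  simp only [expand, a1, a2, a3, b1, b2, b3, c1, c2, c3, one_mul, zero_mul, add_zero,
    zero_add] at hCM
  have e : ∀ s t, len l s t =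
      lenForm s t a * len l i j + lenForm s t b * len l i k + lenForm s t c * len l j k :=
    fun s t => by
    rw [← expand]
    exact congrArg (fun l => len l s t) (hspan l hl)
  rcases twin_of_face_free hCM with h | h | h <;>
    obtain ⟨h1, h2, h3⟩ := h (len l i j) (len l i k) (len l j k) <;>
    rw [← e] at h1 h2 h3
  · refine hasTwins_of_nodup (i := i) (j := m) (k := j) (m := k) (by simp at hnd ⊢; grind) h1 ?_ ?_
    · rw [len_comm l m, h2]
    · rw [len_comm l m, h3]
  · refine hasTwins_of_nodup (i := j) (j := m) (k := i) (m := k) (by simp at hnd ⊢; grind) h2 ?_ ?_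
    · rw [len_comm l m, h1, len_comm l j]
    · rw [len_comm l m, h3]
  · refine hasTwins_of_nodup (i := k) (j := m) (k := i) (m := j) (by simp at hnd ⊢; grind) h3 ?_ ?_
    · rw [len_comm l m, h1, len_comm l k]
    · rw [len_comm l m, h2, len_comm l k]

/-- If `jk` depended on `im`, the triangle `ijk` would separate `W`. With triangles excluded, each
length away from `i` involves only the two edges joining its ends to `i`, as `star_free` requires.
-/
theorem isDegenerate_of_separates_star (hW : Module.finrank ℂ W = 3)
    (hL : (W : Set (Edge 4 → ℂ)) ⊆ L 2 4)
    (hT : ∀ i j k m, [i, j, k, m].Nodup → ¬ Separates W (lenForm i j) (lenForm i k) (lenForm j k))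
    {i j k m : Fin 4} (hnd : [i, j, k, m].Nodup)
    (hs : Separates W (lenForm i j) (lenForm i k) (lenForm i m)) {l : Edge 4 → ℂ} (hl : l ∈ W) :
    IsDegenerate l := by
  obtain ⟨a, ha, b, hb, c, hc, ⟨a1, a2, a3⟩, ⟨b1, b2, b3⟩, ⟨c1, c2, c3⟩, hspan⟩ :=
    hs.exists_dual hW
  have expand := len_combination a b c
  have hjk : lenForm j k c = 0 := by
    by_contra hne
    refine hT i j k m hnd fun v hv h1 h2 h3 => ?_
    rw [hspan v hv, h1, h2, map_add, map_add, map_smul, map_smul, map_smul] at h3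
    have h4 : lenForm i m v = 0 := by simpa [hne] using h3
    exact hs v hv h1 h2 h4
  have hjm : lenForm j m b = 0 := by
    by_contra hne
    refine hT i j m k (by simp at hnd ⊢; grind) fun v hv h1 h2 h3 => ?_
    rw [hspan v hv, h1, h2, map_add, map_add, map_smul, map_smul, map_smul] at h3
    have h4 : lenForm i k v = 0 := by simpa [hne] using h3
    exact hs v hv h1 h4 h2
  have hkm : lenForm k m a = 0 := by
    by_contra hne
    refine hT i k m j (by simp at hnd ⊢; grind) fun v hv h1 h2 h3 => ?_
    rw [hspan v hv, h1, h2, map_add, map_add, map_smul, map_smul, map_smul] at h3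
    have h4 : lenForm i j v = 0 := by simpa [hne] using h3
    exact hs v hv h4 h1 h2
  have hCM : ∀ x y z : ℂ, _ := fun x y z => cayleyMenger_len_eq_zero
    (hL (W.add_mem (W.add_mem (W.smul_mem x ha) (W.smul_mem y hb)) (W.smul_mem z hc))) i j k m
  simp only [expand, a1, a2, a3, b1, b2, b3, c1, c2, c3, one_mul, zero_mul, add_zero,
    zero_add, hjk, hjm, hkm] at hCM
  have e : ∀ s t, len l s t =
      lenForm s t a * len l i j + lenForm s t b * len l i k + lenForm s t c * len l i m :=
    fun s t => by
    rw [← expand]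
    exact congrArg (fun l => len l s t) (hspan l hl)
  have ejk := e j k
  have ejm := e j m
  have ekm := e k m
  rw [hjk, zero_mul, add_zero] at ejk
  rw [hjm, zero_mul, add_zero] at ejm
  rw [hkm, zero_mul, zero_add] at ekm
  rcases star_free hCM with ⟨h1, h2, h3, h4, h5, h6⟩ | ⟨h1, h2, h3, h4, h5, h6, h7⟩
  · refine Or.inr (Or.inr (hasNullFace_of_nodup hnd ?_ ?_ ?_))
    · rw [ejk, h1, h2]; ring
    · rw [ejm, h3, h4]; ring
    · rw [ekm, h5, h6]; ring
  · generalize lenForm j k a = α at *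
    generalize lenForm j k b = β at *
    generalize lenForm j m a = γ at *
    generalize lenForm j m c = δ at *
    generalize lenForm k m b = ε at *
    generalize lenForm k m c = ζ at *
    have h8 : α * β * γ * δ = -(ε * ζ) := by
      linear_combination ε * ζ * h7 - α * β * γ * δ * (ζ ^ 2 * h5 + h6)
    -- With `i` at 0 and `j` at `len l i j`, the other positions come from `(α * x + β * y) ^ 2 = (x
    -- + α * β * y) ^ 2` for signs `α`, `β`; `h8` makes the edge `km` consistent.
    refine Or.inl (isCollinear_of_nodup hnd 0 (len l i j) (-(α * β) * len l i k)
      (-(γ * δ) * len l i m) ?_ ?_ ?_ ?_ ?_ ?_)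
    · ring
    · linear_combination -len l i k ^ 2 * (β ^ 2 * h1 + h2)
    · linear_combination -len l i m ^ 2 * (δ ^ 2 * h3 + h4)
    · rw [ejk]
      linear_combination (len l i j ^ 2 - β ^ 2 * len l i k ^ 2) * h1
    · rw [ejm]
      linear_combination (len l i j ^ 2 - δ ^ 2 * len l i m ^ 2) * h3
    · rw [ekm]
      linear_combination len l i k ^ 2 * (h5 - β ^ 2 * h1 - h2)
        + len l i m ^ 2 * (h6 - δ ^ 2 * h3 - h4) + 2 * len l i k * len l i m * h8

/-- Excluding triangles and stars removes the components of `ik` and `jm` along both end edges of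
the path, so these two lengths are multiples of `jk`. -/
theorem not_separates_path (hW : Module.finrank ℂ W = 3)
    (hL : (W : Set (Edge 4 → ℂ)) ⊆ L 2 4)
    (hT : ∀ i j k m, [i, j, k, m].Nodup → ¬ Separates W (lenForm i j) (lenForm i k) (lenForm j k))
    (hS : ∀ i j k m, [i, j, k, m].Nodup → ¬ Separates W (lenForm i j) (lenForm i k) (lenForm i m))
    {i j k m : Fin 4} (hnd : [i, j, k, m].Nodup) :
    ¬ Separates W (lenForm i j) (lenForm j k) (lenForm k m) := by
  intro hs
  obtain ⟨a, ha, b, hb, c, hc, ⟨a1, a2, a3⟩, ⟨b1, b2, b3⟩, ⟨c1, c2, c3⟩, hspan⟩ :=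
    hs.exists_dual hW
  have comm : ∀ s t : Fin 4, lenForm s t = lenForm t s := fun s t =>
    LinearMap.ext fun v => len_comm v s t
  have expand := len_combination a b c
  have hjm : lenForm j m c = 0 := by
    by_contra hne
    refine hS j i k m (by simp at hnd ⊢; grind) fun v hv h1 h2 h3 => ?_
    rw [comm] at h1
    rw [hspan v hv, h1, h2, map_add, map_add, map_smul, map_smul, map_smul] at h3
    have h4 : lenForm k m v = 0 := by simpa [hne] using h3
    exact hs v hv h1 h2 h4
  have hik : lenForm i k a = 0 := by
    by_contra hne
    refine hS k i j m (by simp at hnd ⊢; grind) fun v hv h1 h2 h3 => ?_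
    rw [comm k j] at h2
    rw [comm k i, hspan v hv, h2, h3, map_add, map_add, map_smul, map_smul, map_smul] at h1
    have h4 : lenForm i j v = 0 := by simpa [hne] using h1
    exact hs v hv h4 h2 h3
  have hik' : lenForm i k c = 0 := by
    by_contra hne
    refine hT i j k m hnd fun v hv h1 h2 h3 => ?_
    rw [hspan v hv, h1, h3, map_add, map_add, map_smul, map_smul, map_smul] at h2
    have h4 : lenForm k m v = 0 := by simpa [hne] using h2
    exact hs v hv h1 h3 h4
  have hjm' : lenForm j m a = 0 := by
    by_contra hne
    refine hT j k m i (by simp at hnd ⊢; grind) fun v hv h1 h2 h3 => ?_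
    rw [hspan v hv, h1, h3, map_add, map_add, map_smul, map_smul, map_smul] at h2
    have h4 : lenForm i j v = 0 := by simpa [hne] using h2
    exact hs v hv h4 h1 h3
  have hCM : ∀ x y z : ℂ, _ := fun x y z => cayleyMenger_len_eq_zero
    (hL (W.add_mem (W.add_mem (W.smul_mem x ha) (W.smul_mem y hb)) (W.smul_mem z hc))) i j k m
  simp only [expand, a1, a2, a3, b1, b2, b3, c1, c2, c3, one_mul, zero_mul, add_zero,
    zero_add, hjm, hik, hik', hjm'] at hCM
  exact path_not_free hCM

/-- Every point of a three-dimensional subspace of `L_{2,4}` is singular. -/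
theorem isDegenerate_of_mem_subspace (hW : Module.finrank ℂ W = 3)
    (hL : (W : Set (Edge 4 → ℂ)) ⊆ L 2 4) {l : Edge 4 → ℂ} (hl : l ∈ W) : IsDegenerate l := by
  by_cases hT : ∀ i j k m, [i, j, k, m].Nodup →
      ¬ Separates W (lenForm i j) (lenForm i k) (lenForm j k)
  · by_cases hS : ∀ i j k m, [i, j, k, m].Nodup →
        ¬ Separates W (lenForm i j) (lenForm i k) (lenForm i m)
    · obtain ⟨i, j, k, m, hnd, h | h | h⟩ := exists_separates_len hW
      · exact absurd h (hT i j k m hnd)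
      · exact absurd h (hS i j k m hnd)
      · exact absurd h (not_separates_path hW hL hT hS hnd)
    · push Not at hS
      obtain ⟨i, j, k, m, hnd, hs⟩ := hS
      exact isDegenerate_of_separates_star hW hL hT hnd hs hl
  · push Not at hT
    obtain ⟨i, j, k, m, hnd, hs⟩ := hT
    exact Or.inr (Or.inl (hasTwins_of_separates_triangle hW hL hnd hs hl))

end Subspace

/-! ### The sixty subspaces -/

/-- The smallest and the largest of the two vertices that are not endpoints of an edge. -/
def opposite (e : Edge 4) : Fin 4 × Fin 4 :=
  (if e.1.1 ≠ 0 then 0 else if e.1.2 ≠ 1 then 1 else 2,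
    if e.1.2 ≠ 3 then 3 else if e.1.1 ≠ 2 then 2 else 1)

theorem opposite_nodup (e : Edge 4) : [e.1.1, e.1.2, (opposite e).1, (opposite e).2].Nodup := by
  decide +revert

/-- The index set of the linear subspaces: sign patterns of collinear configurations, edges
joining coincident points with two signs, and null faces given by the opposite vertex. -/
abbrev PlaneIndex : Type := (ℤˣ × ℤˣ × ℤˣ × ℤˣ × ℤˣ) ⊕ (Edge 4 × ℤˣ × ℤˣ) ⊕ Fin 4

/-- Three linear equations of a subspace. -/
def planeEq {R : Type*} [CommRing R] (l : Edge 4 → R) : PlaneIndex → Fin 3 → R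
  | .inl (a, b, c, d, e) =>
    ![len l 1 2 - (a : ℤ) * len l 0 1 - (b : ℤ) * len l 0 2,
      len l 1 3 - (c : ℤ) * len l 0 1 - (d : ℤ) * len l 0 3,
      -- Only five signs are free: the product of all six must be `-1`, as in `star_free`.
      len l 2 3 - (e : ℤ) * len l 0 2 + (a * b * c * d * e : ℤ) * len l 0 3]
  | .inr (.inl (e, s, t)) =>
    ![len l e.1.1 e.1.2,
      len l e.1.1 (opposite e).1 - (s : ℤ) * len l e.1.2 (opposite e).1,
      len l e.1.1 (opposite e).2 - (t : ℤ) * len l e.1.2 (opposite e).2]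
  | .inr (.inr i) =>
    ![len l (i.succAbove 0) (i.succAbove 1), len l (i.succAbove 0) (i.succAbove 2),
      len l (i.succAbove 1) (i.succAbove 2)]

/-- An integral point of a subspace which lies on no other one. -/
def planePoint : PlaneIndex → Edge 4 → ℤ
  | .inl (a, b, c, d, e) => fun x =>
    -- The widely spaced values 1, 10, 100 prevent accidental sign relations.
    !![0, 1, 10, 100;
       0, 0, (a : ℤ) + (b : ℤ) * 10, (c : ℤ) + (d : ℤ) * 100;
       0, 0, 0, (e : ℤ) * 10 - (a * b * c * d * e : ℤ) * 100;
       0, 0, 0, 0] x.1.1 x.1.2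
  | .inr (.inl (e, s, t)) => fun x =>
    if Joins x e.1.2 (opposite e).1 then 1 else if Joins x e.1.1 (opposite e).1 then s else
    if Joins x e.1.2 (opposite e).2 then 10 else if Joins x e.1.1 (opposite e).2 then t * 10 else
    if Joins x (opposite e).1 (opposite e).2 then 100 else 0
  | .inr (.inr i) => fun x =>
    if x.1.1 = i ∨ x.1.2 = i then 10 ^ (x.1.1 + x.1.2 : ℕ) else 0

theorem planeEq_planePoint (i : PlaneIndex) (r : Fin 3) : planeEq (planePoint i) i r = 0 := by
  revert i r
  decide +kernel

set_option synthInstance.maxSize 1000 in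
theorem eq_of_planeEq_planePoint (i j : PlaneIndex) (h : ∀ r, planeEq (planePoint i) j r = 0) :
    i = j := by
  have h : ∀ i j : PlaneIndex, (∀ r, planeEq (planePoint i) j r = 0) → i = j := by
    decide +kernel
  exact h i j ‹_›

/-- Each equation has a coordinate of its own with coefficient one, so the three are independent.
Working over `ℤ` makes this decidable; `planeEq_intCast` carries it to `ℂ`. -/
theorem exists_planeEq_single (i : PlaneIndex) : ∃ e₀ e₁ e₂ : Edge 4,
    planeEq (Pi.single e₀ (1 : ℤ)) i = ![1, 0, 0] ∧
    planeEq (Pi.single e₁ (1 : ℤ)) i = ![0, 1, 0] ∧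
    planeEq (Pi.single e₂ (1 : ℤ)) i = ![0, 0, 1] := by
  have h : ∀ i : PlaneIndex, (∃ e, planeEq (Pi.single e (1 : ℤ)) i = ![1, 0, 0]) ∧
      (∃ e, planeEq (Pi.single e (1 : ℤ)) i = ![0, 1, 0]) ∧
      ∃ e, planeEq (Pi.single e (1 : ℤ)) i = ![0, 0, 1] := by
    decide +kernel
  obtain ⟨⟨e₀, h₀⟩, ⟨e₁, h₁⟩, e₂, h₂⟩ := h i
  exact ⟨e₀, e₁, e₂, h₀, h₁, h₂⟩

/-- The count is 32 + 24 + 4. -/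
theorem card_planeIndex : Fintype.card PlaneIndex = 60 := by
  decide +kernel

theorem len_intCast {n : ℕ} (l : Edge n → ℤ) (i j : Fin n) :
    len (fun e => (l e : ℂ)) i j = ((len l i j : ℤ) : ℂ) := by
  unfold len
  split_ifs <;> simp

theorem planeEq_intCast (l : Edge 4 → ℤ) (i : PlaneIndex) (r : Fin 3) :
    planeEq (fun e => (l e : ℂ)) i r = ((planeEq l i r : ℤ) : ℂ) := by
  rcases i with ⟨a, b, c, d, e⟩ | ⟨e, s, t⟩ | i <;> fin_cases r <;>
    simp [planeEq, len_intCast]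

/-- The equations of a subspace, as a linear map. -/
def planeMap (i : PlaneIndex) : (Edge 4 → ℂ) →ₗ[ℂ] (Fin 3 → ℂ) where
  toFun l := planeEq l i
  map_add' l l' := by
    have h : ∀ i j, len (l + l') i j = len l i j + len l' i j := fun i j =>
      map_add (lenForm i j) l l'
    funext r
    rcases i with ⟨a, b, c, d, e⟩ | ⟨e, s, t⟩ | i <;> fin_cases r <;>
      simp [planeEq, h] <;> ring
  map_smul' x l := by
    have h : ∀ i j, len (x • l) i j = x * len l i j := fun i j => map_smul (lenForm i j) x l
    funext r
    rcases i with ⟨a, b, c, d, e⟩ | ⟨e, s, t⟩ | i <;> fin_cases r <;>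
      simp [planeEq, h] <;> ring

/-- The three-dimensional linear subspaces of `L_{2,4}`. -/
def plane (i : PlaneIndex) : Submodule ℂ (Edge 4 → ℂ) := LinearMap.ker (planeMap i)

theorem mem_plane_iff {i : PlaneIndex} {l : Edge 4 → ℂ} : l ∈ plane i ↔ ∀ r, planeEq l i r = 0 :=
  LinearMap.mem_ker.trans funext_iff

theorem finrank_plane (i : PlaneIndex) : Module.finrank ℂ (plane i) = 3 := by
  have hsurj : Function.Surjective (planeMap i) := by
    obtain ⟨e₀, e₁, e₂, h₀, h₁, h₂⟩ := exists_planeEq_single i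
    have hsingle : ∀ e r, planeMap i (Pi.single e 1) r = (planeEq (Pi.single e 1) i r : ℤ) := by
      intro e r
      rw [← planeEq_intCast]
      change planeEq _ i r = _
      congr 1
      funext x
      simp [Pi.single_apply]
    intro y
    refine ⟨y 0 • Pi.single e₀ 1 + y 1 • Pi.single e₁ 1 + y 2 • Pi.single e₂ 1, funext fun r => ?_⟩
    simp only [map_add, map_smul, Pi.add_apply, Pi.smul_apply, hsingle, h₀, h₁, h₂]
    fin_cases r <;> simp
  have h := (planeMap i).finrank_range_add_finrank_ker
  rw [LinearMap.range_eq_top.2 hsurj, finrank_top, Module.finrank_fin_fun,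
    Module.finrank_fintype_fun_eq_card, show Fintype.card (Edge 4) = 6 from rfl] at h
  change Module.finrank ℂ (LinearMap.ker (planeMap i)) = 3
  omega

theorem plane_injective : Function.Injective plane := by
  intro i j hij
  refine eq_of_planeEq_planePoint i j fun r => ?_
  have h : (fun e => (planePoint i e : ℂ)) ∈ plane i :=
    mem_plane_iff.2 fun r => by rw [planeEq_intCast, planeEq_planePoint, Int.cast_zero]
  rw [hij, mem_plane_iff] at h
  have := h r
  rw [planeEq_intCast] at this
  exact_mod_cast this

theorem exists_units_mul_of_sq_eq_sq {x y : ℂ} (h : x ^ 2 = y ^ 2) :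
    ∃ s : ℤˣ, x = ((s : ℤ) : ℂ) * y := by
  rcases sq_eq_sq_iff_eq_or_eq_neg.1 h with h | h
  · exact ⟨1, by simp [h]⟩
  · exact ⟨-1, by simp [h]⟩

theorem intCast_units_sq (s : ℤˣ) : (((s : ℤ) : ℂ)) ^ 2 = 1 := by
  rcases Int.units_eq_one_or s with rfl | rfl <;> simp

theorem isDegenerate_of_mem_plane {i : PlaneIndex} {l : Edge 4 → ℂ} (hl : l ∈ plane i) :
    IsDegenerate l := by
  rw [mem_plane_iff] at hl
  have h0 := hl 0
  have h1 := hl 1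
  have h2 := hl 2
  clear hl
  rcases i with ⟨a, b, c, d, e⟩ | ⟨e, s, t⟩ | i
  · have qa := intCast_units_sq a
    have qb := intCast_units_sq b
    have qc := intCast_units_sq c
    have qd := intCast_units_sq d
    have qe := intCast_units_sq e
    simp only [planeEq, Matrix.cons_val, Int.cast_mul] at h0 h1 h2
    generalize ((a : ℤ) : ℂ) = a at *
    generalize ((b : ℤ) : ℂ) = b at *
    generalize ((c : ℤ) : ℂ) = c at *
    generalize ((d : ℤ) : ℂ) = d at *
    generalize ((e : ℤ) : ℂ) = e at *
    have e0 : len l 1 2 = a * len l 0 1 + b * len l 0 2 := by linear_combination h0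
    have e1 : len l 1 3 = c * len l 0 1 + d * len l 0 3 := by linear_combination h1
    have e2 : len l 2 3 = e * (len l 0 2 - a * b * c * d * len l 0 3) := by
      linear_combination h2
    refine Or.inl (isCollinear_of_nodup (i := 0) (j := 1) (k := 2) (m := 3) (by decide) 0
      (len l 0 1) (-(a * b) * len l 0 2) (-(c * d) * len l 0 3) ?_ ?_ ?_ ?_ ?_ ?_)
    · ring
    · linear_combination -len l 0 2 ^ 2 * (b ^ 2 * qa + qb)
    · linear_combination -len l 0 3 ^ 2 * (d ^ 2 * qc + qd)
    · rw [e0]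
      linear_combination (len l 0 1 ^ 2 - b ^ 2 * len l 0 2 ^ 2) * qa
    · rw [e1]
      linear_combination (len l 0 1 ^ 2 - d ^ 2 * len l 0 3 ^ 2) * qc
    · have qab : (a * b) ^ 2 = 1 := by rw [mul_pow, qa, qb, one_mul]
      rw [e2, mul_pow, qe]
      linear_combination (-len l 0 2 ^ 2 + (c * d) ^ 2 * len l 0 3 ^ 2) * qab
  · simp only [planeEq, Matrix.cons_val] at h0 h1 h2
    refine Or.inr (Or.inl (hasTwins_of_nodup (opposite_nodup e) ?_ ?_ ?_))
    · rw [h0]; ring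
    · rw [sub_eq_zero.1 h1, mul_pow, intCast_units_sq, one_mul]
    · rw [sub_eq_zero.1 h2, mul_pow, intCast_units_sq, one_mul]
  · simp only [planeEq, Matrix.cons_val] at h0 h1 h2
    refine Or.inr (Or.inr (hasNullFace_of_nodup (i := i) ?_ h0 h1 h2))
    clear h0 h1 h2
    decide +revert

theorem exists_mem_plane_of_isDegenerate {l : Edge 4 → ℂ} (hl : IsDegenerate l) :
    ∃ i, l ∈ plane i := by
  rcases hl with ⟨q, hq⟩ | ⟨i, j, hij, h⟩ | ⟨i, h⟩
  · obtain ⟨s₁, h₁⟩ := exists_units_mul_of_sq_eq_sq (hq 0 1).symm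
    obtain ⟨s₂, h₂⟩ := exists_units_mul_of_sq_eq_sq (hq 0 2).symm
    obtain ⟨s₃, h₃⟩ := exists_units_mul_of_sq_eq_sq (hq 0 3).symm
    obtain ⟨t₁, k₁⟩ := exists_units_mul_of_sq_eq_sq (hq 1 2)
    obtain ⟨t₂, k₂⟩ := exists_units_mul_of_sq_eq_sq (hq 1 3)
    obtain ⟨t₃, k₃⟩ := exists_units_mul_of_sq_eq_sq (hq 2 3)
    have a₁ := intCast_units_sq s₁
    have a₂ := intCast_units_sq s₂
    have b₁ := intCast_units_sq t₁
    have b₂ := intCast_units_sq t₂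
    -- The signs come from expanding each difference through vertex 0, as in `q 1 - q 2 = (q 0 - q
    -- 2) - (q 0 - q 1)`. The sixth sign `t₃ * s₃` then agrees with the prescribed one because the
    -- squares of signs cancel.
    refine ⟨.inl (-(t₁ * s₁), t₁ * s₂, -(t₂ * s₁), t₂ * s₃, -(t₃ * s₂)), mem_plane_iff.2 fun r => ?_⟩
    fin_cases r
    · simp [planeEq]
      linear_combination k₁ - (t₁ : ℤ) * h₁ + (t₁ : ℤ) * h₂
    · simp [planeEq]
      linear_combination k₂ - (t₂ : ℤ) * h₁ + (t₂ : ℤ) * h₃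
    · simp [planeEq]
      linear_combination k₃ - (t₃ : ℤ) * h₂ + (t₃ : ℤ) * h₃ - (s₃ : ℤ) * (t₃ : ℤ) * len l 0 3 *
        ((t₂ : ℤ) ^ 2 * (s₁ : ℤ) ^ 2 * (s₂ : ℤ) ^ 2 * b₁ + (s₁ : ℤ) ^ 2 * (s₂ : ℤ) ^ 2 * b₂
          + (s₂ : ℤ) ^ 2 * a₁ + a₂)
  · wlog hlt : i < j generalizing i j
    · exact this j i hij.symm (fun k => (h k).symm) (lt_of_le_of_ne (not_lt.1 hlt) hij.symm)
    obtain ⟨e, he⟩ : ∃ e : Edge 4, e = ⟨(i, j), hlt⟩ := ⟨_, rfl⟩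
    obtain ⟨s, hs⟩ := exists_units_mul_of_sq_eq_sq (h (opposite e).1)
    obtain ⟨t, ht⟩ := exists_units_mul_of_sq_eq_sq (h (opposite e).2)
    refine ⟨.inr (.inl (e, s, t)), mem_plane_iff.2 fun r => ?_⟩
    have h0 : len l i j = 0 := by simpa [len_self] using h j
    subst he
    fin_cases r
    · exact h0
    · exact sub_eq_zero.2 hs
    · exact sub_eq_zero.2 ht
  · refine ⟨.inr (.inr i), mem_plane_iff.2 fun r => ?_⟩
    fin_cases r <;> exact h _ _ (Fin.succAbove_ne _ _) (Fin.succAbove_ne _ _)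

/-! ### Classification of the linear subspaces -/

theorem exists_le_plane {W : Submodule ℂ (Edge 4 → ℂ)} (hW : ∀ l ∈ W, IsDegenerate l) :
    ∃ i, W ≤ plane i := by
  -- A vector space over an infinite field is not a finite union of proper subspaces.
  obtain ⟨i, hi⟩ := Subspace.exists_eq_top_of_iUnion_eq_univ
    (p := fun i : PlaneIndex => (plane i).comap W.subtype) (by
      refine Set.eq_univ_of_forall fun l => Set.mem_iUnion.2 ?_
      exact exists_mem_plane_of_isDegenerate (hW l l.2))
  exact ⟨i, Submodule.comap_subtype_eq_top.1 hi⟩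

theorem exists_le_finrank_eq {K V : Type*} [Field K] [AddCommGroup V] [Module K V]
    [FiniteDimensional K V] {U W : Submodule K V} (hUW : U ≤ W) {n : ℕ}
    (hU : Module.finrank K U ≤ n) (hW : n ≤ Module.finrank K W) :
    ∃ U', U ≤ U' ∧ U' ≤ W ∧ Module.finrank K U' = n := by
  induction n with
  | zero => exact ⟨U, le_rfl, hUW, Nat.le_zero.1 hU⟩
  | succ n ih =>
    rcases hU.eq_or_lt with h | h
    · exact ⟨U, le_rfl, hUW, h⟩
    obtain ⟨U', h1, h2, h3⟩ := ih (by omega) (by omega)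
    obtain ⟨w, hw, hw'⟩ := SetLike.exists_of_lt (lt_of_le_of_ne h2 (by rintro rfl; omega))
    refine ⟨U' ⊔ K ∙ w, h1.trans le_sup_left,
      sup_le h2 ((Submodule.span_singleton_le_iff_mem _ _).2 hw), ?_⟩
    rw [Submodule.finrank_sup_span_singleton hw', h3]

theorem finrank_lt_four_of_subset_L {W : Submodule ℂ (Edge 4 → ℂ)}
    (hL : (W : Set (Edge 4 → ℂ)) ⊆ L 2 4) : Module.finrank ℂ W < 4 := by
  by_contra! h4
  -- Each vector of `W` is degenerate because its span extends to a three-dimensional subspace of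
  -- `W`.
  obtain ⟨i, hi⟩ := exists_le_plane (W := W) fun l hl => by
    obtain ⟨U, h1, h2, h3⟩ := exists_le_finrank_eq (n := 3)
      ((Submodule.span_singleton_le_iff_mem l W).2 hl)
      ((finrank_span_le_card {l}).trans (by simp)) (by omega)
    exact isDegenerate_of_mem_subspace h3 (fun x hx => hL (h2 hx))
      (h1 (Submodule.mem_span_singleton_self l))
  have := Submodule.finrank_mono hi
  rw [finrank_plane] at this
  omega

theorem subset_L_iff_mem_range_plane {W : Submodule ℂ (Edge 4 → ℂ)}
    (hW : Module.finrank ℂ W = 3) : (W : Set (Edge 4 → ℂ)) ⊆ L 2 4 ↔ W ∈ Set.range plane := by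
  constructor
  · intro hL
    obtain ⟨i, hi⟩ := exists_le_plane fun l hl => isDegenerate_of_mem_subspace hW hL hl
    exact ⟨i, (Submodule.eq_of_le_of_finrank_eq hi (by rw [hW, finrank_plane])).symm⟩
  · rintro ⟨i, rfl⟩ l hl
    exact (mem_singularLocus_iff_isDegenerate.2 (isDegenerate_of_mem_plane hl)).1

theorem singularLocus_L : singularLocus (L 2 4) = ⋃ i, (plane i : Set (Edge 4 → ℂ)) := by
  ext l
  rw [mem_singularLocus_iff_isDegenerate, Set.mem_iUnion]
  exact ⟨exists_mem_plane_of_isDegenerate, fun ⟨_, hi⟩ => isDegenerate_of_mem_plane hi⟩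

end UnsquaredMeasurement

theorem mainTheorem6 :
    ∃ S : Set (Submodule ℂ (UnsquaredMeasurement.Edge 4 → ℂ)),
      S.ncard = 60 ∧
      (∀ W ∈ S, Module.finrank ℂ W = 3) ∧
      (UnsquaredMeasurement.singularLocus (UnsquaredMeasurement.L 2 4) =
        ⋃ W ∈ S, (W : Set (UnsquaredMeasurement.Edge 4 → ℂ))) ∧
      (∀ W : Submodule ℂ (UnsquaredMeasurement.Edge 4 → ℂ), Module.finrank ℂ W = 3 →
        ((W : Set (UnsquaredMeasurement.Edge 4 → ℂ)) ⊆ UnsquaredMeasurement.L 2 4 ↔ W ∈ S)) ∧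
      (∀ W : Submodule ℂ (UnsquaredMeasurement.Edge 4 → ℂ), 4 ≤ Module.finrank ℂ W →
        ¬ (W : Set (UnsquaredMeasurement.Edge 4 → ℂ)) ⊆ UnsquaredMeasurement.L 2 4) := by
  refine ⟨Set.range UnsquaredMeasurement.plane, ?_, ?_, ?_, ?_, ?_⟩
  · rw [← Set.image_univ, Set.ncard_image_of_injective _ UnsquaredMeasurement.plane_injective,
      Set.ncard_univ, Nat.card_eq_fintype_card, UnsquaredMeasurement.card_planeIndex]
  · rintro _ ⟨i, rfl⟩
    exact UnsquaredMeasurement.finrank_plane i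
  · rw [UnsquaredMeasurement.singularLocus_L, Set.biUnion_range]
  · exact fun W hW => UnsquaredMeasurement.subset_L_iff_mem_range_plane hW
  · exact fun W hW hL =>
      absurd (UnsquaredMeasurement.finrank_lt_four_of_subset_L hL) (not_lt.2 hW)
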